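/- Let $G$ be a locally compact (Hausdorff) group with left Haar measure. A continuous 2-cocycle on $G$ is a continuous function $\sigma:G\times G\to\mathbb{T}$ with $\sigma(s,t)\sigma(st,r)=\sigma(s,tr)\sigma(t,r)$ and $\sigma(s,e)=\sigma(e,t)=1$ for all $s,t,r\in G$. For such $\sigma$ let $\lambda_\sigma(s)f(t)=\sigma(s,s^{-1}t)f(s^{-1}t)$ be the left regular $\sigma$-representation on $L^2(G)$, let $VN(G,\sigma)\subseteq B(L^2(G))$ be the von Neumann algebra generated by $\{\lambda_\sigma(s):s\in G\}$, and let the twisted Fourier space $A(G,\sigma)=VN(G,\sigma)_*$ be its predual, with its canonical operator space structure as a predual. An element $\psi\in A(G,\sigma)$ is identified with the function $\psi(s)=\langle\lambda_\sigma(s),\psi\rangle$ on $G$. For continuous 2-cocycles $\sigma_1,\sigma_2$, let $M_{cb}(A(G,\sigma_1),A(G,\sigma_2))$ be the set of all functions $\varphi:G\to\mathbb{C}$ such that $\varphi\psi\in A(G,\sigma_2)$ for all $\psi\in A(G,\sigma_1)$ and such that the map $m_\varphi:A(G,\sigma_1)\to A(G,\sigma_2)$, $\psi\mapsto\varphi\psi$,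 is completely bounded, with the norm $\|\varphi\|_{M_{cb}(A(G,\sigma_1),A(G,\sigma_2))}=\|m_\varphi\|_{cb}$. **Theorem.** Let $\sigma_1,\sigma_2$ be continuous 2-cocycles on $G$, let $\sigma=\overline{\sigma_1}\sigma_2$, and let $\varphi:G\to\mathbb{C}$ be a function. Then $\varphi\in M_{cb}(A(G,\sigma_1),A(G,\sigma_2))$ if and only if there exist a Hilbert space $\mathcal{H}$ and bounded continuous functions $\xi,\eta:G\to\mathcal{H}$ such that $$\sigma(t,s)\,\varphi(ts)=\langle\xi(s),\eta(t)\rangle,\qquad s,t\in G.$$ Moreover, $$\|\varphi\|_{M_{cb}(A(G,\sigma_1),A(G,\sigma_2))}=\inf\{\|\xi\|_\infty\,\|\eta\|_\infty\},$$ where the infimum runs over all such $\mathcal{H}$, $\xi$ and $\eta$ (both sides being $+\infty$ if $\varphi\notin M_{cb}(A(G,\sigma_1),A(G,\sigma_2))$). -/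

import Mathlib

open MeasureTheory
open scoped ENNReal

set_option linter.unusedSectionVars false

universe u

noncomputable section

namespace TwistedFourier

/-! ### Von Neumann algebras: generation, preduals, operator space structures -/

section OperatorSpace

variable {H : Type*} [NormedAddCommGroup H] [InnerProductSpace ℂ H] [CompleteSpace H]

/-- The von Neumann algebra generated by a set `S` of bounded operators on `H`: the bicommutant
of `S ∪ S*`. -/
def generatedVN (S : Set (H →L[ℂ] H)) : VonNeumannAlgebra H where
  toStarSubalgebra := StarSubalgebra.centralizer ℂ (StarSubalgebra.centralizer ℂ S : Set (H →L[ℂ] H))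
  centralizer_centralizer' := by
    show Set.centralizer (Set.centralizer (StarSubalgebra.centralizer ℂ
      (StarSubalgebra.centralizer ℂ S : Set (H →L[ℂ] H)) : Set (H →L[ℂ] H))) = _
    rw [StarSubalgebra.coe_centralizer_centralizer, Set.centralizer_centralizer_centralizer]
    exact (StarSubalgebra.coe_centralizer_centralizer ℂ S).symm

theorem coe_generatedVN (S : Set (H →L[ℂ] H)) :
    ((generatedVN S).toStarSubalgebra : Set (H →L[ℂ] H)) = (S ∪ star S).centralizer.centralizer :=
  StarSubalgebra.coe_centralizer_centralizer ℂ S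

theorem subset_generatedVN (S : Set (H →L[ℂ] H)) :
    S ⊆ ((generatedVN S).toStarSubalgebra : Set (H →L[ℂ] H)) := by
  rw [coe_generatedVN]
  exact Set.subset_union_left.trans Set.subset_centralizer_centralizer

/-- The normal functionals on a von Neumann algebra `M ⊆ B(H)`, that is, all restrictions to `M` of `∑ₙ ω_{ξₙ,ηₙ}` with `∑ₙ ‖ξₙ‖ ‖ηₙ‖ < ∞`, where
`ω_{ξ,η}(T) = ⟨Tξ, η⟩` (linear in `Tξ`). -/
def normalFunctionals (M : VonNeumannAlgebra H) :
    Submodule ℂ (M.toStarSubalgebra →ₗ[ℂ] ℂ) where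
  carrier := {ψ | ∃ ξ η : ℕ → H, Summable (fun n => ‖ξ n‖ * ‖η n‖) ∧
    ∀ T : M.toStarSubalgebra, HasSum (fun n => inner ℂ (η n) ((T : H →L[ℂ] H) (ξ n))) (ψ T)}
  zero_mem' := ⟨0, 0, by simp, fun T => by simp⟩
  add_mem' := by
    rintro ψ₁ ψ₂ ⟨ξ₁, η₁, h₁, e₁⟩ ⟨ξ₂, η₂, h₂, e₂⟩
    let e : ℕ ≃ ℕ ⊕ ℕ := Equiv.natSumNatEquivNat.symm
    refine ⟨fun n => Sum.elim ξ₁ ξ₂ (e n), fun n => Sum.elim η₁ η₂ (e n), ?_, fun T => ?_⟩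
    · refine (e.summable_iff (f := fun x : ℕ ⊕ ℕ => ‖Sum.elim ξ₁ ξ₂ x‖ * ‖Sum.elim η₁ η₂ x‖)).2 ?_
      exact (HasSum.sum (f := fun x : ℕ ⊕ ℕ => ‖Sum.elim ξ₁ ξ₂ x‖ * ‖Sum.elim η₁ η₂ x‖)
        h₁.hasSum h₂.hasSum).summable
    · refine (e.hasSum_iff (f := fun x : ℕ ⊕ ℕ =>
        inner ℂ (Sum.elim η₁ η₂ x) ((T : H →L[ℂ] H) (Sum.elim ξ₁ ξ₂ x)))).2 ?_
      exact HasSum.sum (f := fun x : ℕ ⊕ ℕ =>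
        inner ℂ (Sum.elim η₁ η₂ x) ((T : H →L[ℂ] H) (Sum.elim ξ₁ ξ₂ x))) (e₁ T) (e₂ T)
  smul_mem' := by
    rintro c ψ ⟨ξ, η, h, e⟩
    refine ⟨fun n => c • ξ n, η, ?_, fun T => ?_⟩
    · simpa [norm_smul, mul_assoc] using h.mul_left ‖c‖
    · simpa [inner_smul_right] using (e T).mul_left c

/-- The predual `M_*` of a von Neumann algebra `M ⊆ B(H)`: the space of normal functionals. -/
def Predual (M : VonNeumannAlgebra H) : Type _ := normalFunctionals M

instance (M : VonNeumannAlgebra H) : AddCommGroup (Predual M) :=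
  inferInstanceAs (AddCommGroup (normalFunctionals M))

instance (M : VonNeumannAlgebra H) : Module ℂ (Predual M) :=
  inferInstanceAs (Module ℂ (normalFunctionals M))

/-- The value `⟨T, ψ⟩` of the functional `ψ ∈ M_*` at `T ∈ M`. -/
def Predual.pairing (M : VonNeumannAlgebra H) : Predual M →ₗ[ℂ] (M.toStarSubalgebra →ₗ[ℂ] ℂ) :=
  (normalFunctionals M).subtype

theorem Predual.pairing_injective (M : VonNeumannAlgebra H) :
    Function.Injective (Predual.pairing M) :=
  Subtype.val_injective

/-- The operator on `ℓ²_k ⊗ H = H ⊕ ⋯ ⊕ H` given by a `k × k` matrix of bounded operators on `H`.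
Its operator norm is the norm of the matrix in `M_k(B(H))`. -/
def matrixOp {k : ℕ} (T : Matrix (Fin k) (Fin k) (H →L[ℂ] H)) :
    PiLp 2 (fun _ : Fin k => H) →L[ℂ] PiLp 2 (fun _ : Fin k => H) :=
  ((PiLp.continuousLinearEquiv 2 ℂ (fun _ : Fin k => H)).symm :
      (Fin k → H) →L[ℂ] PiLp 2 (fun _ : Fin k => H)) ∘L
    (ContinuousLinearMap.pi fun i => ∑ j, T i j ∘L ContinuousLinearMap.proj j) ∘L
    ((PiLp.continuousLinearEquiv 2 ℂ (fun _ : Fin k => H)) :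
      PiLp 2 (fun _ : Fin k => H) →L[ℂ] (Fin k → H))

theorem matrixOp_apply {k : ℕ} (T : Matrix (Fin k) (Fin k) (H →L[ℂ] H))
    (x : PiLp 2 (fun _ : Fin k => H)) (i : Fin k) : matrixOp T x i = ∑ j, T i j (x j) := by
  simp [matrixOp]

/-- The canonical operator space structure of the predual `M_*`, as a subspace of the operator
space dual `M^*`: a matrix `[ψ_{ij}]` in `M_n(M_*)` has the norm of the map
`M → M_n, T ↦ [ψ_{ij}(T)]` in `CB(M, M_n)`, that is, the supremum of
`‖[ψ_{ij}(T_{pq})]‖` over all `k` and all `[T_{pq}]` in the unit ball of `M_k(M)`. -/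
def predualMatrixNorm {M : VonNeumannAlgebra H} {n : ℕ}
    (ψ : Matrix (Fin n) (Fin n) (Predual M)) : ℝ≥0∞ :=
  ⨆ (k : ℕ) (T : Matrix (Fin k) (Fin k) M.toStarSubalgebra)
    (_ : ‖matrixOp (T.map fun x => (x : H →L[ℂ] H))‖ ≤ 1),
    ‖Matrix.toEuclideanCLM (𝕜 := ℂ) (Matrix.of fun a b : Fin k × Fin n =>
      Predual.pairing M (ψ a.2 b.2) (T a.1 b.1))‖ₑ

/-- The cb-norm `sup_n ‖I_n ⊗ m : M_n(M_*) → M_n(N_*)‖` of a linear map `m : M_* → N_*`, with the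
value `∞` if `m` is not completely bounded. -/
def cbNorm {K : Type*} [NormedAddCommGroup K] [InnerProductSpace ℂ K] [CompleteSpace K]
    {M : VonNeumannAlgebra H} {N : VonNeumannAlgebra K} (m : Predual M →ₗ[ℂ] Predual N) : ℝ≥0∞ :=
  ⨆ (n : ℕ) (ψ : Matrix (Fin n) (Fin n) (Predual M)) (_ : predualMatrixNorm ψ ≤ 1),
    predualMatrixNorm (ψ.map m)

theorem memℓp_diag (T : H →L[ℂ] H) (x : lp (fun _ : ℕ => H) 2) :
    Memℓp (fun n => T (x n)) 2 :=
  Memℓp.mono' (g := fun n => ((‖T‖ : ℂ) • x) n) (lp.memℓp _) fun n => by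
    rw [lp.coeFn_smul, Pi.smul_apply, norm_smul, Complex.norm_real, norm_norm]
    exact T.le_opNorm (x n)

/-- The diagonal amplification of `T` to `ℓ²(ℕ, H)`. -/
def diag (T : H →L[ℂ] H) : lp (fun _ : ℕ => H) 2 →L[ℂ] lp (fun _ : ℕ => H) 2 :=
  LinearMap.mkContinuous
    { toFun := fun x => ⟨fun n => T (x n), memℓp_diag T x⟩
      map_add' := fun x y => by ext n; exact map_add T (x n) (y n)
      map_smul' := fun c x => by ext n; exact map_smul T c (x n) } ‖T‖ fun x => by
    have h := lp.norm_mono (p := 2) (by norm_num)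
      (x := (⟨fun n => T (x n), memℓp_diag T x⟩ : lp (fun _ : ℕ => H) 2))
      (y := (‖T‖ : ℂ) • x) fun n => by
        rw [lp.coeFn_smul, Pi.smul_apply, norm_smul, Complex.norm_real, norm_norm]
        exact T.le_opNorm (x n)
    rw [norm_smul, Complex.norm_real, norm_norm] at h
    exact h

@[simp] theorem diag_apply (T : H →L[ℂ] H) (x : lp (fun _ : ℕ => H) 2) (n : ℕ) :
    diag T x n = T (x n) := rfl

theorem inner_diag_left (T : H →L[ℂ] H) (x y : lp (fun _ : ℕ => H) 2) :
    inner ℂ (diag T x) y = inner ℂ x (diag (star T) y) := by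
  rw [lp.inner_eq_tsum, lp.inner_eq_tsum]
  exact tsum_congr fun n => (ContinuousLinearMap.adjoint_inner_right T (x n) (y n)).symm

/-- A normal functional which vanishes on a self-adjoint multiplicatively closed set `S` containing
`1` vanishes on the bicommutant of `S`. -/
theorem predual_eq_zero {M : VonNeumannAlgebra H} (S : Set (H →L[ℂ] H)) (h1 : 1 ∈ S)
    (hmul : ∀ a ∈ S, ∀ b ∈ S, a * b ∈ S) (hstar : ∀ a ∈ S, star a ∈ S)
    (hSM : S ⊆ M.toStarSubalgebra)
    (hMS : (M.toStarSubalgebra : Set (H →L[ℂ] H)) ⊆ S.centralizer.centralizer)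
    (ψ : Predual M)
    (hψ : ∀ T : M.toStarSubalgebra, (T : H →L[ℂ] H) ∈ S →
      Predual.pairing M ψ T = 0) : ψ = 0 := by
  obtain ⟨ψ, ξ, η, hsum, he⟩ := ψ
  change ∀ T : M.toStarSubalgebra, (T : H →L[ℂ] H) ∈ S → ψ T = 0 at hψ
  -- rescale so that both sequences are square summable
  let r : ℕ → ℝ := fun n => Real.sqrt (‖η n‖ / ‖ξ n‖)
  have hr : ∀ n, r n ^ 2 = ‖η n‖ / ‖ξ n‖ := fun n => Real.sq_sqrt (by positivity)
  have hx : Memℓp (fun n => ((r n : ℂ)) • ξ n) 2 := by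
    refine memℓp_gen (hsum.congr fun n => ?_)
    have : ‖((r n : ℂ)) • ξ n‖ ^ 2 = ‖ξ n‖ * ‖η n‖ := by
      rw [norm_smul, mul_pow, Complex.norm_real, Real.norm_eq_abs, sq_abs, hr]
      by_cases h : ‖ξ n‖ = 0
      · simp [h]
      · field_simp
    simpa using this.symm
  have hy : Memℓp (fun n => (((r n)⁻¹ : ℝ) : ℂ) • η n) 2 := by
    refine memℓp_gen (hsum.congr fun n => ?_)
    have : ‖(((r n)⁻¹ : ℝ) : ℂ) • η n‖ ^ 2 = ‖ξ n‖ * ‖η n‖ := by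
      rw [norm_smul, mul_pow, Complex.norm_real, Real.norm_eq_abs, sq_abs, inv_pow, hr, inv_div]
      by_cases h : ‖η n‖ = 0
      · simp [h]
      · field_simp
    simpa using this.symm
  let x : lp (fun _ : ℕ => H) 2 := ⟨_, hx⟩
  let y : lp (fun _ : ℕ => H) 2 := ⟨_, hy⟩
  have key : ∀ T : M.toStarSubalgebra, inner ℂ y (diag (T : H →L[ℂ] H) x) = ψ T := by
    intro T
    rw [lp.inner_eq_tsum, ← (he T).tsum_eq]
    refine tsum_congr fun n => ?_
    show inner ℂ ((((r n)⁻¹ : ℝ) : ℂ) • η n) ((T : H →L[ℂ] H) ((r n : ℂ) • ξ n)) = _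
    rw [map_smul, inner_smul_left, inner_smul_right, Complex.conj_ofReal, ← mul_assoc,
      ← Complex.ofReal_mul]
    by_cases h : r n = 0
    · have h2 : ‖η n‖ / ‖ξ n‖ = 0 := by rw [← hr n, h]; simp
      rcases div_eq_zero_iff.1 h2 with h3 | h3
      · simp [norm_eq_zero.1 h3]
      · simp [norm_eq_zero.1 h3]
    · rw [inv_mul_cancel₀ h]; simp
  let K : Submodule ℂ (lp (fun _ : ℕ => H) 2) :=
    (Submodule.span ℂ ((fun a => diag a x) '' S)).topologicalClosure
  have hKS : ∀ a ∈ S, ∀ v ∈ K, diag a v ∈ K := by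
    intro a ha
    have h0 : Submodule.span ℂ ((fun a => diag a x) '' S) ≤
        K.comap (diag a : lp (fun _ : ℕ => H) 2 →ₗ[ℂ] lp (fun _ : ℕ => H) 2) := by
      rw [Submodule.span_le]
      rintro _ ⟨b, hb, rfl⟩
      exact Submodule.le_topologicalClosure _ (Submodule.subset_span ⟨a * b, hmul a ha b hb, rfl⟩)
    have hcl : IsClosed (K.comap (diag a : lp (fun _ : ℕ => H) 2 →ₗ[ℂ] lp (fun _ : ℕ => H) 2) :
        Set (lp (fun _ : ℕ => H) 2)) :=
      (Submodule.isClosed_topologicalClosure _).preimage (diag a).continuous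
    exact fun v hv => Submodule.topologicalClosure_minimal _ h0 hcl hv
  have : CompleteSpace K :=
    (Submodule.isClosed_topologicalClosure _).completeSpace_coe
  let P := K.starProjection
  have hPS : ∀ a ∈ S, ∀ v, P (diag a v) = diag a (P v) := by
    intro a ha v
    refine Submodule.eq_starProjection_of_mem_of_inner_eq_zero
      (hKS a ha _ (Submodule.starProjection_apply_mem K v)) fun w hw => ?_
    rw [← map_sub, inner_diag_left]
    exact Submodule.starProjection_inner_eq_zero v _ (hKS _ (hstar a ha) w hw)
  have hsing : ∀ (T : H →L[ℂ] H) (j : ℕ) (v : H),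
      diag T (lp.single 2 j v) = lp.single 2 j (T v) := by
    intro T j v
    ext n
    by_cases h : n = j
    · subst h; simp
    · simp [h]
  have hPT : ∀ T : M.toStarSubalgebra, P ∘L diag (T : H →L[ℂ] H) = diag (T : H →L[ℂ] H) ∘L P := by
    intro T
    refine lp.ext_continuousLinearMap (by norm_num) fun j => ?_
    ext v i
    let Q : H →L[ℂ] H := lp.evalCLM ℂ (fun _ : ℕ => H) 2 i ∘L P ∘L
      lp.singleContinuousLinearMap ℂ (fun _ : ℕ => H) 2 j
    have hQ : ∀ w, Q w = P (lp.single 2 j w) i := fun w => rfl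
    have hQS : Q ∈ S.centralizer := by
      intro a ha
      ext w
      show a (Q w) = Q (a w)
      rw [hQ, hQ, ← hsing, hPS a ha, diag_apply]
    have h := hMS T.2 Q hQS
    have h' : Q ((T : H →L[ℂ] H) v) = (T : H →L[ℂ] H) (Q v) := congrArg (fun A => A v) h
    show P (diag (T : H →L[ℂ] H) (lp.single 2 j v)) i = (T : H →L[ℂ] H) (P (lp.single 2 j v) i)
    rw [hsing, ← hQ, ← hQ, h']
  have hxK : x ∈ K := Submodule.le_topologicalClosure _
    (Submodule.subset_span ⟨1, h1, by ext n; rfl⟩)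
  have hyK : ∀ v ∈ K, inner ℂ y v = 0 := by
    have h0 : Submodule.span ℂ ((fun a => diag a x) '' S) ≤
        LinearMap.ker (innerSL ℂ y : lp (fun _ : ℕ => H) 2 →ₗ[ℂ] ℂ) := by
      rw [Submodule.span_le]
      rintro _ ⟨b, hb, rfl⟩
      show inner ℂ y (diag b x) = 0
      exact (key ⟨b, hSM hb⟩).trans (hψ _ hb)
    have hcl : IsClosed (LinearMap.ker (innerSL ℂ y : lp (fun _ : ℕ => H) 2 →ₗ[ℂ] ℂ) :
        Set (lp (fun _ : ℕ => H) 2)) :=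
      isClosed_singleton.preimage (innerSL ℂ y).continuous
    exact fun v hv => Submodule.topologicalClosure_minimal _ h0 hcl hv
  refine Predual.pairing_injective M (LinearMap.ext fun T => ?_)
  have hTx : diag (T : H →L[ℂ] H) x ∈ K := by
    have h2 : P x = x := Submodule.starProjection_eq_self_iff.2 hxK
    have h3 : P (diag (T : H →L[ℂ] H) x) = diag (T : H →L[ℂ] H) (P x) :=
      congrArg (fun A => A x) (hPT T)
    rw [h2] at h3
    exact Submodule.starProjection_eq_self_iff.1 h3
  exact (key T).symm.trans (hyK _ hTx)

end OperatorSpace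

/-! ### Continuous 2-cocycles -/

/-- A continuous 2-cocycle on `G` with values in the circle `{z ∈ ℂ : |z| = 1}`. -/
structure ContTwoCocycle (G : Type*) [Group G] [TopologicalSpace G] where
  toFun : G → G → ℂ
  norm_eq_one' : ∀ s t, ‖toFun s t‖ = 1
  continuous' : Continuous fun p : G × G => toFun p.1 p.2
  cocycle' : ∀ s t r, toFun s t * toFun (s * t) r = toFun s (t * r) * toFun t r
  right_one' : ∀ s, toFun s 1 = 1
  left_one' : ∀ t, toFun 1 t = 1

namespace ContTwoCocycle

variable {G : Type*} [Group G] [TopologicalSpace G]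

instance : CoeFun (ContTwoCocycle G) (fun _ => G → G → ℂ) := ⟨toFun⟩

/-- The pointwise product of two cocycles. -/
instance : Mul (ContTwoCocycle G) where
  mul σ τ :=
    { toFun := fun s t => σ s t * τ s t
      norm_eq_one' := fun s t => by rw [norm_mul, σ.norm_eq_one', τ.norm_eq_one', mul_one]
      continuous' := σ.continuous'.mul τ.continuous'
      cocycle' := fun s t r => by
        rw [mul_mul_mul_comm, σ.cocycle', τ.cocycle', mul_mul_mul_comm]
      right_one' := fun s => by rw [σ.right_one', τ.right_one', mul_one]
      left_one' := fun s => by rw [σ.left_one', τ.left_one', mul_one] }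

/-- The complex conjugate of a cocycle. -/
instance : Star (ContTwoCocycle G) where
  star σ :=
    { toFun := fun s t => star (σ s t)
      norm_eq_one' := fun s t => by rw [norm_star, σ.norm_eq_one']
      continuous' := σ.continuous'.star
      cocycle' := fun s t r => by rw [← star_mul', σ.cocycle', star_mul']
      right_one' := fun s => by rw [σ.right_one', star_one]
      left_one' := fun s => by rw [σ.left_one', star_one] }

theorem mul_apply (σ τ : ContTwoCocycle G) (s t : G) : (σ * τ) s t = σ s t * τ s t := rfl

theorem star_apply (σ : ContTwoCocycle G) (s t : G) : (star σ) s t = star (σ s t) := rfl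

end ContTwoCocycle

/-! ### Twisted regular representation, twisted von Neumann algebra, twisted Fourier space -/

section Group

variable {G : Type u} [Group G] [TopologicalSpace G] [IsTopologicalGroup G]
  [MeasurableSpace G] [BorelSpace G]

theorem memLp_regular (σ : ContTwoCocycle G) (μ : Measure G) [μ.IsHaarMeasure] (s : G)
    (f : Lp ℂ 2 μ) : MemLp (fun t => σ s (s⁻¹ * t) * f (s⁻¹ * t)) 2 μ := by
  have h1 : MemLp (fun t => f (s⁻¹ * t)) 2 μ :=
    (Lp.memLp f).comp_measurePreserving (measurePreserving_mul_left μ s⁻¹)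
  have hc : Continuous fun t => σ s (s⁻¹ * t) :=
    σ.continuous'.comp (continuous_const.prodMk (continuous_const.mul continuous_id))
  refine MemLp.of_le h1 (hc.measurable.aestronglyMeasurable.mul h1.1) ?_
  exact Filter.Eventually.of_forall fun t => by simp [σ.norm_eq_one']

/-- The operator `λ_σ(s)` of the left regular `σ`-representation on `L²(G)`:
`(λ_σ(s) f)(t) = σ(s, s⁻¹t) f(s⁻¹t)`. -/
def regularRep (σ : ContTwoCocycle G) (μ : Measure G) [μ.IsHaarMeasure] (s : G) :
    Lp ℂ 2 μ →L[ℂ] Lp ℂ 2 μ :=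
  LinearMap.mkContinuous
    { toFun := fun f => (memLp_regular σ μ s f).toLp _
      map_add' := fun f g => by
        rw [← MemLp.toLp_add]
        refine MemLp.toLp_congr _ _ ?_
        have := (measurePreserving_mul_left μ s⁻¹).quasiMeasurePreserving.ae_eq_comp
          (Lp.coeFn_add f g)
        filter_upwards [this] with t ht
        simp only [Function.comp_apply, Pi.add_apply] at ht
        simp only [Pi.add_apply, ht, mul_add]
      map_smul' := fun c f => by
        rw [RingHom.id_apply, ← MemLp.toLp_const_smul]
        refine MemLp.toLp_congr _ _ ?_
        have := (measurePreserving_mul_left μ s⁻¹).quasiMeasurePreserving.ae_eq_comp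
          (Lp.coeFn_smul c f)
        filter_upwards [this] with t ht
        simp only [Function.comp_apply, Pi.smul_apply, smul_eq_mul] at ht
        simp only [Pi.smul_apply, smul_eq_mul, ht]
        ring } 1 fun f => by
    have h : eLpNorm (fun t => σ s (s⁻¹ * t) * f (s⁻¹ * t)) 2 μ = eLpNorm f 2 μ := by
      rw [← eLpNorm_comp_measurePreserving (Lp.aestronglyMeasurable f)
        (measurePreserving_mul_left μ s⁻¹)]
      exact eLpNorm_congr_norm_ae (Filter.Eventually.of_forall fun t => by simp [σ.norm_eq_one'])
    rw [one_mul, Lp.norm_def f, ← h]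
    exact (Lp.norm_toLp _ (memLp_regular σ μ s f)).le

theorem regularRep_apply (σ : ContTwoCocycle G) (μ : Measure G) [μ.IsHaarMeasure] (s : G)
    (f : Lp ℂ 2 μ) :
    regularRep σ μ s f =ᵐ[μ] fun t => σ s (s⁻¹ * t) * f (s⁻¹ * t) :=
  MemLp.coeFn_toLp (memLp_regular σ μ s f)

theorem regularRep_mul (σ : ContTwoCocycle G) (μ : Measure G) [μ.IsHaarMeasure] (s t : G) :
    regularRep σ μ s * regularRep σ μ t = σ s t • regularRep σ μ (s * t) := by
  ext1 f
  refine Lp.ext ?_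
  have h1 := regularRep_apply σ μ s (regularRep σ μ t f)
  have h2 := (measurePreserving_mul_left μ s⁻¹).quasiMeasurePreserving.ae_eq_comp
    (regularRep_apply σ μ t f)
  have h3 := Lp.coeFn_smul (σ s t) (regularRep σ μ (s * t) f)
  have h4 := regularRep_apply σ μ (s * t) f
  filter_upwards [h1, h2, h3, h4] with x h1 h2 h3 h4
  have hc := σ.cocycle' s t (t⁻¹ * (s⁻¹ * x))
  rw [mul_inv_cancel_left] at hc
  simp only [Function.comp_apply] at h2
  rw [mul_apply_eq_comp, h1, h2, smul_apply, h3, Pi.smul_apply, h4,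
    smul_eq_mul, mul_inv_rev, mul_assoc t⁻¹ s⁻¹ x]
  linear_combination (-f (t⁻¹ * (s⁻¹ * x))) * hc

theorem regularRep_one (σ : ContTwoCocycle G) (μ : Measure G) [μ.IsHaarMeasure] :
    regularRep σ μ 1 = 1 := by
  ext1 f
  refine Lp.ext ?_
  filter_upwards [regularRep_apply σ μ 1 f] with x h1
  rw [h1, σ.left_one']
  simp

theorem norm_regularRep_apply (σ : ContTwoCocycle G) (μ : Measure G) [μ.IsHaarMeasure] (s : G)
    (f : Lp ℂ 2 μ) : ‖regularRep σ μ s f‖ = ‖f‖ := by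
  have h : eLpNorm (fun t => σ s (s⁻¹ * t) * f (s⁻¹ * t)) 2 μ = eLpNorm f 2 μ := by
    rw [← eLpNorm_comp_measurePreserving (Lp.aestronglyMeasurable f)
      (measurePreserving_mul_left μ s⁻¹)]
    exact eLpNorm_congr_norm_ae (Filter.Eventually.of_forall fun t => by simp [σ.norm_eq_one'])
  rw [Lp.norm_def, Lp.norm_def, eLpNorm_congr_ae (regularRep_apply σ μ s f), h]

theorem star_regularRep (σ : ContTwoCocycle G) (μ : Measure G) [μ.IsHaarMeasure] (s : G) :
    star (regularRep σ μ s) =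
      star (σ s⁻¹ s) • regularRep σ μ s⁻¹ := by
  have h1 : star (regularRep σ μ s) * regularRep σ μ s = 1 := by
    rw [ContinuousLinearMap.star_eq_adjoint]
    exact (ContinuousLinearMap.norm_map_iff_adjoint_comp_self _).1 (norm_regularRep_apply σ μ s)
  have h2 : regularRep σ μ s * regularRep σ μ s⁻¹ = σ s s⁻¹ • 1 := by
    rw [regularRep_mul, mul_inv_cancel, regularRep_one]
  have hs : σ s s⁻¹ = σ s⁻¹ s := by
    have := σ.cocycle' s s⁻¹ s
    rwa [mul_inv_cancel, inv_mul_cancel, σ.left_one', σ.right_one', mul_one, one_mul] at this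
  have h3 := congrArg (fun T => star (regularRep σ μ s) * T) h2
  simp only [← mul_assoc, h1, one_mul, mul_smul_comm, mul_one] at h3
  rw [h3, hs, smul_smul, Complex.star_def, Complex.conj_mul', σ.norm_eq_one']
  simp

/-- The twisted group von Neumann algebra `VN(G, σ)`, generated by the operators `λ_σ(s)`. -/
def twistedVN (σ : ContTwoCocycle G) (μ : Measure G) [μ.IsHaarMeasure] :
    VonNeumannAlgebra (Lp ℂ 2 μ) :=
  generatedVN (Set.range (regularRep σ μ))

/-- `λ_σ(s)` as an element of `VN(G, σ)`. -/
def regularRepVN (σ : ContTwoCocycle G) (μ : Measure G) [μ.IsHaarMeasure] (s : G) :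
    (twistedVN σ μ).toStarSubalgebra :=
  ⟨regularRep σ μ s, subset_generatedVN _ ⟨s, rfl⟩⟩

/-- The twisted Fourier space `A(G, σ)`, the predual of `VN(G, σ)`. -/
abbrev FourierSpace (σ : ContTwoCocycle G) (μ : Measure G) [μ.IsHaarMeasure] :
    Type _ :=
  Predual (twistedVN σ μ)

/-- The canonical identification of the elements of `A(G, σ)` with functions on `G`:
`ψ(s) = ⟨λ_σ(s), ψ⟩`. -/
def FourierSpace.toFun (σ : ContTwoCocycle G) (μ : Measure G) [μ.IsHaarMeasure] :
    FourierSpace σ μ →ₗ[ℂ] (G → ℂ) where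
  toFun ψ s := Predual.pairing _ ψ (regularRepVN σ μ s)
  map_add' _ _ := rfl
  map_smul' _ _ := rfl

/-- An element of `A(G, σ)` is determined by the function on `G` that it defines. -/
theorem FourierSpace.toFun_injective (σ : ContTwoCocycle G) (μ : Measure G) [μ.IsHaarMeasure] :
    Function.Injective (FourierSpace.toFun σ μ) := by
  rw [injective_iff_map_eq_zero]
  intro ψ hψ
  let S : Set (Lp ℂ 2 μ →L[ℂ] Lp ℂ 2 μ) := {T | ∃ (c : ℂ) (s : G), T = c • regularRep σ μ s}
  have hsub : Set.range (regularRep σ μ) ∪ star (Set.range (regularRep σ μ)) ⊆ S := by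
    rintro T (⟨s, rfl⟩ | ⟨s, hs⟩)
    · exact ⟨1, s, (one_smul _ _).symm⟩
    · exact ⟨_, s⁻¹, by rw [← star_star T, ← hs, star_regularRep]⟩
  have hSM : S ⊆ (twistedVN σ μ).toStarSubalgebra := by
    rintro _ ⟨c, s, rfl⟩
    exact (twistedVN σ μ).toStarSubalgebra.smul_mem (regularRepVN σ μ s).2 c
  refine predual_eq_zero S ⟨1, 1, by rw [regularRep_one, one_smul]⟩ ?_ ?_ hSM ?_ ψ ?_
  · rintro _ ⟨c, s, rfl⟩ _ ⟨d, t, rfl⟩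
    refine ⟨c * d * σ s t, s * t, ?_⟩
    rw [smul_mul_smul_comm, regularRep_mul, smul_smul]
  · rintro _ ⟨c, s, rfl⟩
    exact ⟨_, s⁻¹, by rw [star_smul, star_regularRep, smul_smul]⟩
  · rw [twistedVN, coe_generatedVN]
    exact Set.centralizer_subset (Set.centralizer_subset hsub)
  · rintro T ⟨c, s, hT⟩
    have h : T = c • regularRepVN σ μ s := Subtype.ext hT
    have h0 : Predual.pairing _ ψ (regularRepVN σ μ s) = 0 :=
      congrFun hψ s
    rw [h, map_smul, h0, smul_zero]

/-! ### Multipliers -/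

/-- `φ : G → ℂ` is a `(σ₁, σ₂)`-multiplier if `φψ ∈ A(G, σ₂)` for all `ψ ∈ A(G, σ₁)`. -/
def IsMultiplier (σ₁ σ₂ : ContTwoCocycle G) (μ : Measure G) [μ.IsHaarMeasure] (φ : G → ℂ) : Prop :=
  ∀ ψ : FourierSpace σ₁ μ, ∃ θ : FourierSpace σ₂ μ,
    ∀ s : G, FourierSpace.toFun σ₂ μ θ s = φ s * FourierSpace.toFun σ₁ μ ψ s

/-- The map `m_φ : A(G, σ₁) → A(G, σ₂)`, `ψ ↦ φψ`, defined by a multiplier `φ`. -/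
def IsMultiplier.map {σ₁ σ₂ : ContTwoCocycle G} {μ : Measure G} [μ.IsHaarMeasure] {φ : G → ℂ}
    (h : IsMultiplier σ₁ σ₂ μ φ) : FourierSpace σ₁ μ →ₗ[ℂ] FourierSpace σ₂ μ where
  toFun ψ := (h ψ).choose
  map_add' ψ₁ ψ₂ := FourierSpace.toFun_injective σ₂ μ <| funext fun s => by
    have e : ∀ ψ, FourierSpace.toFun σ₂ μ (h ψ).choose s = φ s * FourierSpace.toFun σ₁ μ ψ s :=
      fun ψ => (h ψ).choose_spec s
    rw [e, (FourierSpace.toFun σ₂ μ).map_add, (FourierSpace.toFun σ₁ μ).map_add, Pi.add_apply,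
      Pi.add_apply, e, e, mul_add]
  map_smul' c ψ := FourierSpace.toFun_injective σ₂ μ <| funext fun s => by
    have e : ∀ ψ, FourierSpace.toFun σ₂ μ (h ψ).choose s = φ s * FourierSpace.toFun σ₁ μ ψ s :=
      fun ψ => (h ψ).choose_spec s
    rw [e, (FourierSpace.toFun σ₂ μ).map_smul, (FourierSpace.toFun σ₁ μ).map_smul, Pi.smul_apply,
      Pi.smul_apply, RingHom.id_apply, e, smul_eq_mul, smul_eq_mul, mul_left_comm]

theorem IsMultiplier.toFun_map {σ₁ σ₂ : ContTwoCocycle G} {μ : Measure G} [μ.IsHaarMeasure]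
    {φ : G → ℂ} (h : IsMultiplier σ₁ σ₂ μ φ) (ψ : FourierSpace σ₁ μ) (s : G) :
    FourierSpace.toFun σ₂ μ (h.map ψ) s = φ s * FourierSpace.toFun σ₁ μ ψ s :=
  (h ψ).choose_spec s

/-- The norm `‖φ‖ = ‖m_φ‖_cb` of `M_cb(A(G, σ₁), A(G, σ₂))`, with the value `∞` if `φ` is not a
multiplier or if `m_φ` is not completely bounded. -/
def cbMultiplierNorm (σ₁ σ₂ : ContTwoCocycle G) (μ : Measure G) [μ.IsHaarMeasure]
    (φ : G → ℂ) : ℝ≥0∞ :=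
  ⨅ h : IsMultiplier σ₁ σ₂ μ φ, cbNorm h.map

/-- The space `M_cb(A(G, σ₁), A(G, σ₂))` of completely bounded multipliers. -/
def cbMultipliers (σ₁ σ₂ : ContTwoCocycle G) (μ : Measure G) [μ.IsHaarMeasure] : Set (G → ℂ) :=
  {φ | ∃ h : IsMultiplier σ₁ σ₂ μ φ, cbNorm h.map < ∞}

end Group

end TwistedFourier

end

open scoped ComplexConjugate Pointwise

namespace TwistedFourier

/-! ### Positive semidefinite kernels -/

/-! Write `k(t,s) = σ(t,s) φ(ts)`. Both directions rest on maps of the form `Φ(T) = W* (T ⊗ 1) V`,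
with `V`, `W` operators from `L²(G)` to an `ℓ²`-sum of copies of `L²(G)`.

Sufficiency. Given a factorization, let `W` multiply functions in `L²(G)` by `η(t)`, and let `V`
multiply them by `conj σ(t⁻¹,t) ξ(t⁻¹)`. The cocycle identity gives `Φ(λ_{σ₂}(s)) = φ(s) λ_{σ₁}(s)`
(`exists_implementing_ops`). Normal functionals on `VN(G, σ₂)` are determined by their values at the
`λ_{σ₂}(s)`, so `Φ` maps `VN(G, σ₂)` into the bicommutant `VN(G, σ₁)` (`sandwich_mem_twistedVN`).
Since `Φ` is normal, `m_φ` is its preadjoint, and its cb-norm is controlled by the bounds on `V` and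
`W` (`cbNorm_le_of_sandwich`).

Necessity. Let `C` bound the cb-norm of `m_φ`. Evaluating `m_φ` of a matrix of vector functionals at
the matrix `[A_ij λ_{σ₂}(z_i) λ_{σ₂}(z_j)]` shows that Schur multiplication by `k` is bounded by `C`
on finite matrices (`schur_bound_of_cbNorm_le`). By scaling and the AM-GM inequality, this becomes a
positivity statement (`dominated_of_schur_bound`). The M. Riesz extension theorem then completes the
partial kernel on `G ⊔ G` with diagonal `C` and upper right block `k` to a positive semidefinite
kernel, whose Gram vectors factor `k` (`exists_gram_of_dominated`).

These vectors need not be continuous. Multipliers are continuous, so `k` is, and projecting the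
vectors onto suitable closed spans makes them weakly continuous (`exists_weaklyContinuous_gram`).
That is enough to build `V` and `W` as above. For a unit vector `x₀`, the vectors `(λ_{σ₂}(s) ⊗ 1) V
λ_{σ₁}(s)* x₀` and `(λ_{σ₂}(t)* ⊗ 1) W λ_{σ₁}(t) x₀` are norm continuous, obey the same bounds, and
factor `k` again (`exists_continuous_gram`). Both families are bounded by `√C`, which gives the norm
equality. -/

/-- A positive semidefinite kernel is a Gram kernel. -/
theorem exists_gram_of_posSemidef_kernel {X : Type u} (K : X → X → ℂ)
    (hK : ∀ x y, K y x = conj (K x y))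
    (hpos : ∀ v : X →₀ ℂ, 0 ≤ (v.sum fun x a => v.sum fun y b => K x y * conj a * b).re) :
    ∃ (H : Type u) (_ : NormedAddCommGroup H) (_ : InnerProductSpace ℂ H) (_ : CompleteSpace H)
      (e : X → H), ∀ x y, inner ℂ (e x) (e y) = K x y := by
  -- Scalars are viewed as operators on `ℂ`, so that the vector-valued reproducing kernel space
  -- applies; the kernel functions at `1` are the Gram vectors.
  let K' : Matrix X X (ℂ →L[ℂ] ℂ) := .of fun x y => K x y • (1 : ℂ →L[ℂ] ℂ)
  have hK' : K'.PosSemidef := by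
    have h := (RKHS.posSemidef_tfae (K := K')).out 0 2
    refine h.2 ⟨?_, fun v => ?_⟩
    · ext x y
      simp [K', Matrix.conjTranspose_apply, hK x y]
    · refine (hpos v).trans_eq ?_
      simp only [Finsupp.sum, RCLike.re_eq_complex_re]
      congr 1
      refine Finset.sum_congr rfl fun x _ => Finset.sum_congr rfl fun y _ => ?_
      simp [K', hK x y]
      ring
  have : Fact K'.PosSemidef := ⟨hK'⟩
  refine ⟨RKHS.OfKernel K', inferInstance, inferInstance, inferInstance,
    fun x => RKHS.kerFun (RKHS.OfKernel K') x (1 : ℂ), fun x y => ?_⟩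
  rw [← RKHS.kernel_inner, RKHS.OfKernel.kernel_ofKernel]
  simp [K', hK x y]

/-- The evaluation `∑ L(x,y) g(x,y)` of a finitely supported kernel against a kernel. -/
noncomputable abbrev kernelEval {X : Type*} (g : X × X → ℂ) : (X × X →₀ ℂ) →ₗ[ℂ] ℂ :=
  Finsupp.linearCombination ℂ g

/-- The kernel `(x,y) ↦ v(x) conj(v(y))`. -/
def rankOneKernel {X : Type*} (v : X → ℂ) (p : X × X) : ℂ := v p.1 * conj (v p.2)

/-- The finitely supported kernels with positive semidefinite real part. -/
def posKernelCone (X : Type*) : PointedCone ℝ (X × X →₀ ℂ) where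
  carrier := {L | ∀ v : X → ℂ, 0 ≤ (kernelEval (rankOneKernel v) L).re}
  add_mem' := fun ha hb v => by
    rw [map_add, Complex.add_re]; exact add_nonneg (ha v) (hb v)
  zero_mem' := fun v => by simp
  smul_mem' := fun c L hL v => by
    have h : (c • L : X × X →₀ ℂ) = ((c : ℝ) : ℂ) • L := by ext; simp
    rw [h, map_smul, smul_eq_mul, Complex.re_ofReal_mul]
    exact mul_nonneg c.2 (hL v)

/-- The pairs on the diagonal of `(G ⊕ G) × (G ⊕ G)` or in its upper right block. -/
def partialPairs (G : Type*) : Set ((G ⊕ G) × (G ⊕ G)) :=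
  {p | p.1 = p.2 ∨ ∃ s t, p = (Sum.inl s, Sum.inr t)}

/-- Brings a kernel supported on the prescribed pairs into the shape of the domination inequality:
two diagonal sums and one block sum over a common finite set. The lower left block contributes
nothing, since its pairs are not prescribed. -/
theorem kernelEval_of_mem_supported {G : Type*} [DecidableEq G] {L : (G ⊕ G) × (G ⊕ G) →₀ ℂ}
    (hL : L ∈ Finsupp.supported ℂ ℂ (partialPairs G)) : ∃ Z : Finset G,
    ∀ g : (G ⊕ G) × (G ⊕ G) → ℂ, kernelEval g L =
      ∑ s ∈ Z, L (Sum.inl s, Sum.inl s) * g (Sum.inl s, Sum.inl s) +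
      ∑ t ∈ Z, L (Sum.inr t, Sum.inr t) * g (Sum.inr t, Sum.inr t) +
      ∑ t ∈ Z, ∑ s ∈ Z, L (Sum.inl s, Sum.inr t) * g (Sum.inl s, Sum.inr t) := by
  let pr : G ⊕ G → G := Sum.elim id id
  let Z : Finset G := L.support.image (fun p => pr p.1) ∪ L.support.image (fun p => pr p.2)
  have hz : ∀ x y, L (x, y) ≠ 0 → pr x ∈ Z ∧ pr y ∈ Z := fun x y h =>
    ⟨Finset.mem_union_left _ (Finset.mem_image_of_mem (fun p : (G ⊕ G) × (G ⊕ G) => pr p.1)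
        (Finsupp.mem_support_iff.2 h)),
      Finset.mem_union_right _ (Finset.mem_image_of_mem (fun p : (G ⊕ G) × (G ⊕ G) => pr p.2)
        (Finsupp.mem_support_iff.2 h))⟩
  have hmem : ∀ x, pr x ∈ Z → x ∈ Z.disjSum Z := by
    rintro (x | x) hx <;> simpa [pr] using hx
  have h0 : ∀ p, p ∉ partialPairs G → L p = 0 := fun p hp => by
    by_contra h
    exact hp ((Finsupp.mem_supported ℂ L).1 hL (Finsupp.mem_support_iff.2 h))
  refine ⟨Z, fun g => ?_⟩
  have h1 : kernelEval g L = ∑ p ∈ Z.disjSum Z ×ˢ Z.disjSum Z, L p * g p := by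
    rw [kernelEval, Finsupp.linearCombination_apply]
    refine Finsupp.sum_of_support_subset _ (fun p hp => ?_) _ (by simp)
    obtain ⟨a, b⟩ := hz p.1 p.2 (Finsupp.mem_support_iff.1 hp)
    exact Finset.mem_product.2 ⟨hmem _ a, hmem _ b⟩
  rw [h1, Finset.sum_product, Finset.sum_disjSum]
  simp only [Finset.sum_disjSum, Finset.sum_add_distrib]
  have d1 : ∑ s ∈ Z, ∑ s' ∈ Z, L (Sum.inl s, Sum.inl s') * g (Sum.inl s, Sum.inl s') =
      ∑ s ∈ Z, L (Sum.inl s, Sum.inl s) * g (Sum.inl s, Sum.inl s) := by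
    refine Finset.sum_congr rfl fun s hs => Finset.sum_eq_single_of_mem s hs fun b _ hb => ?_
    rw [h0, zero_mul]
    rintro (h | ⟨_, _, h⟩)
    · exact hb (Sum.inl.inj h).symm
    · simp at h
  have d2 : ∑ s ∈ Z, ∑ s' ∈ Z, L (Sum.inr s, Sum.inr s') * g (Sum.inr s, Sum.inr s') =
      ∑ s ∈ Z, L (Sum.inr s, Sum.inr s) * g (Sum.inr s, Sum.inr s) := by
    refine Finset.sum_congr rfl fun s hs => Finset.sum_eq_single_of_mem s hs fun b _ hb => ?_
    rw [h0, zero_mul]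
    rintro (h | ⟨_, _, h⟩)
    · exact hb (Sum.inr.inj h).symm
    · simp at h
  have d3 : ∑ s ∈ Z, ∑ s' ∈ Z, L (Sum.inr s, Sum.inl s') * g (Sum.inr s, Sum.inl s') = 0 := by
    refine Finset.sum_eq_zero fun s _ => Finset.sum_eq_zero fun t _ => ?_
    rw [h0, zero_mul]
    rintro (h | ⟨_, _, h⟩) <;> simp at h
  rw [d1, d2, d3, Finset.sum_comm]
  ring

/-- A domination property for bilinear forms with matrix `B` implies a Hilbert space factorization
of `k`. -/
theorem exists_gram_of_dominated {G : Type u} (k : G → G → ℂ) {C : ℝ}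
    (hk : ∀ (Z : Finset G) (B : G → G → ℂ) (p q : G → ℝ),
      (∀ w u : G → ℂ, (∑ t ∈ Z, ∑ s ∈ Z, B t s * w s * conj (u t)).re ≤
        ∑ s ∈ Z, p s * ‖w s‖ ^ 2 + ∑ t ∈ Z, q t * ‖u t‖ ^ 2) →
      (∑ t ∈ Z, ∑ s ∈ Z, B t s * k t s).re ≤ C * (∑ s ∈ Z, p s + ∑ t ∈ Z, q t)) :
    ∃ (H : Type u) (_ : NormedAddCommGroup H) (_ : InnerProductSpace ℂ H) (_ : CompleteSpace H)
      (ξ η : G → H), (∀ s, ‖ξ s‖ ^ 2 = C) ∧ (∀ t, ‖η t‖ ^ 2 = C) ∧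
        ∀ s t, inner ℂ (η t) (ξ s) = k t s := by
  classical
  let E := ((G ⊕ G) × (G ⊕ G)) →₀ ℂ
  -- The partial kernel to be completed. Only its values on `partialPairs G` matter; the zeros
  -- elsewhere are placeholders.
  let κ : (G ⊕ G) × (G ⊕ G) → ℂ
    | (Sum.inl s, Sum.inr t) => k t s
    | (x, y) => if x = y then (C : ℂ) else 0
  have κd : ∀ x, κ (x, x) = C := by rintro (x | x) <;> simp [κ]
  have κo : ∀ s t, κ (Sum.inl s, Sum.inr t) = k t s := fun s t => rfl
  let D : Submodule ℝ E := (Finsupp.supported ℂ ℂ (partialPairs G)).restrictScalars ℝ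
  let f : E →ₗ[ℝ] ℝ := Complex.reLm ∘ₗ (kernelEval κ).restrictScalars ℝ
  have hf : ∀ L, f L = (kernelEval κ L).re := fun L => rfl
  have hsingle : ∀ (g : (G ⊕ G) × (G ⊕ G) → ℂ) p c, kernelEval g (Finsupp.single p c) = c * g p :=
    fun g p c => by simp [kernelEval]
  have hD : ∀ p ∈ partialPairs G, ∀ c, Finsupp.single p c ∈ D := fun p hp c =>
    Finsupp.single_mem_supported ℂ c hp
  obtain ⟨F, hF1, hF2⟩ := riesz_extension (posKernelCone (G ⊕ G)) (f.toPMap D) (by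
    rintro ⟨L, hL⟩ hpos
    show 0 ≤ f L
    obtain ⟨Z, hZ⟩ := kernelEval_of_mem_supported hL
    -- Positivity of `L` on the rank one kernel of `(w, u)` says that minus its off-diagonal block
    -- is dominated by its diagonals; the hypothesis then says exactly that `f L ≥ 0`.
    have h := hk Z (fun t s => -L (Sum.inl s, Sum.inr t)) (fun s => (L (Sum.inl s, Sum.inl s)).re)
      (fun t => (L (Sum.inr t, Sum.inr t)).re) fun w u => by
        have h1 := hpos (Sum.elim w u)
        rw [hZ] at h1
        simp only [rankOneKernel, Sum.elim_inl, Sum.elim_inr, Complex.mul_conj,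
          Complex.normSq_eq_norm_sq, Complex.add_re, Complex.re_sum, Complex.re_mul_ofReal,
          ← mul_assoc] at h1
        simp only [neg_mul, Complex.re_sum, Complex.neg_re, Finset.sum_neg_distrib]
        linarith
    rw [hf, hZ]
    simp only [κd, κo, Complex.add_re, Complex.re_sum, Complex.re_mul_ofReal]
    simp only [neg_mul, Complex.re_sum, Complex.neg_re, Finset.sum_neg_distrib] at h
    simp only [← Finset.sum_mul]
    linarith) (by
    intro y
    induction y using Finsupp.induction_linear with
    | zero => exact ⟨0, by simp⟩
    | add y z hy hz =>
      obtain ⟨a, ha⟩ := hy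
      obtain ⟨b, hb⟩ := hz
      refine ⟨a + b, ?_⟩
      have := add_mem ha hb
      rwa [add_add_add_comm] at this
    | single p c =>
      -- Diagonal weights `‖c‖` absorb an arbitrary entry `c`, because `|c v w̄| ≤ ‖c‖ (|v|² +
      -- |w|²)`. This is the cofinality condition in the Riesz theorem.
      refine ⟨⟨Finsupp.single (p.1, p.1) (‖c‖ : ℂ) + Finsupp.single (p.2, p.2) (‖c‖ : ℂ),
        D.add_mem (hD _ (Or.inl rfl) _) (hD _ (Or.inl rfl) _)⟩, fun v => ?_⟩
      rw [map_add, map_add, hsingle, hsingle, hsingle]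
      simp only [rankOneKernel, Complex.mul_conj, Complex.normSq_eq_norm_sq, Complex.add_re,
        ← Complex.ofReal_mul, Complex.ofReal_re]
      have h1 := Complex.abs_re_le_norm (c * (v p.1 * conj (v p.2)))
      rw [norm_mul, norm_mul, RCLike.norm_conj] at h1
      have h2 := neg_abs_le (c * (v p.1 * conj (v p.2))).re
      nlinarith [norm_nonneg c, mul_nonneg (norm_nonneg c) (sq_nonneg (‖v p.1‖ - ‖v p.2‖)),
        mul_nonneg (norm_nonneg c) (add_nonneg (sq_nonneg ‖v p.1‖) (sq_nonneg ‖v p.2‖))])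
  -- The complex kernel representing the real functional, `F (single (y, x) c) = Re (c K x y)`. The
  -- arguments are swapped to match an inner product conjugate linear in its first variable.
  let K : G ⊕ G → G ⊕ G → ℂ := fun x y =>
    ⟨F (Finsupp.single (y, x) 1), -F (Finsupp.single (y, x) Complex.I)⟩
  have hK : ∀ x y c, F (Finsupp.single (y, x) c) = (c * K x y).re := by
    intro x y c
    have : (Finsupp.single (y, x) c : E) = c.re • Finsupp.single (y, x) (1 : ℂ) +
        c.im • Finsupp.single (y, x) Complex.I := by
      rw [Finsupp.smul_single, Finsupp.smul_single, ← Finsupp.single_add]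
      congr 1
      apply Complex.ext <;> simp
    rw [this, map_add, map_smul, map_smul]
    simp [K]
  have hext : ∀ x y z, (∀ c, F (Finsupp.single (y, x) c) = (c * z).re) → K x y = z := by
    intro x y z h
    apply Complex.ext
    · simpa [K] using h 1
    · have := h Complex.I
      simp at this
      simp [K, this]
  have hKp : ∀ x y, (y, x) ∈ partialPairs G → K x y = κ (y, x) := fun x y h =>
    hext _ _ _ fun c => by
      rw [← hsingle κ, ← hf]
      exact hF1 ⟨_, hD _ h c⟩
  have hKs : ∀ x y, K y x = conj (K x y) := fun x y => hext _ _ _ fun c => by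
    -- On every rank one kernel this difference has real part zero, so it lies in the cone for `c`
    -- and for `-c`; hence `F` vanishes on it.
    have h : ∀ a : ℂ, 0 ≤ F (Finsupp.single (x, y) a - Finsupp.single (y, x) (conj a)) := by
      refine fun a => hF2 _ fun v => ?_
      rw [map_sub, hsingle, hsingle]
      simp only [rankOneKernel, Complex.sub_re, Complex.mul_re, Complex.mul_im, Complex.conj_re,
        Complex.conj_im]
      linarith
    have h1 := h c
    have h2 := h (-c)
    rw [map_sub, sub_nonneg] at h1 h2
    rw [map_neg, Finsupp.single_neg, Finsupp.single_neg, map_neg, map_neg] at h2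
    rw [le_antisymm (neg_le_neg_iff.1 h2) h1, hK]
    simp
  obtain ⟨H, i1, i2, i3, e, he⟩ := exists_gram_of_posSemidef_kernel K hKs fun v => by
    -- Against the rank one kernel of `w`, this `L` evaluates to `|∑ v w|²`, so it lies in the cone.
    let L : E := ∑ x ∈ v.support, ∑ y ∈ v.support, Finsupp.single (y, x) (conj (v x) * v y)
    have h1 : 0 ≤ F L := hF2 _ fun w => by
      simp only [L, map_sum, hsingle, rankOneKernel]
      have : ∑ x ∈ v.support, ∑ y ∈ v.support, conj (v x) * v y * (w y * conj (w x)) =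
          (∑ y ∈ v.support, v y * w y) * conj (∑ x ∈ v.support, v x * w x) := by
        rw [map_sum, Finset.sum_mul_sum, Finset.sum_comm]
        refine Finset.sum_congr rfl fun x _ => Finset.sum_congr rfl fun y _ => ?_
        rw [map_mul]; ring
      rw [this, Complex.mul_conj, Complex.ofReal_re]
      exact Complex.normSq_nonneg _
    simp only [L, map_sum, hK] at h1
    simp only [Finsupp.sum, Complex.re_sum]
    refine h1.trans_eq (Finset.sum_congr rfl fun x _ => Finset.sum_congr rfl fun y _ => ?_)
    congr 1
    ring
  have hn : ∀ x, ‖e x‖ ^ 2 = C := fun x => by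
    have h1 := inner_self_eq_norm_sq (𝕜 := ℂ) (e x)
    rw [he, hKp x x (Or.inl rfl), κd] at h1
    rw [← h1]
    simp
  exact ⟨H, i1, i2, i3, fun s => e (Sum.inl s), fun t => e (Sum.inr t), fun s => hn _,
    fun t => hn _, fun s t => (he _ _).trans (hKp _ _ (Or.inr ⟨s, t, rfl⟩))⟩

/-! ### Schur multipliers -/

/-- If Schur multiplication by `k` on finite matrices is bounded by `C`, then the domination
property of `exists_gram_of_dominated` holds. -/
theorem dominated_of_schur_bound {G : Type*} (k : G → G → ℂ) {C : ℝ} (hC : 0 ≤ C)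
    (hk : ∀ (Z : Finset G) (a : G → G → ℂ),
      (∀ w u : G → ℂ, ‖∑ t ∈ Z, ∑ s ∈ Z, a t s * w s * conj (u t)‖ ^ 2 ≤
        (∑ s ∈ Z, ‖w s‖ ^ 2) * ∑ t ∈ Z, ‖u t‖ ^ 2) →
      ∀ w u : G → ℂ, ‖∑ t ∈ Z, ∑ s ∈ Z, a t s * k t s * w s * conj (u t)‖ ^ 2 ≤
        C ^ 2 * ((∑ s ∈ Z, ‖w s‖ ^ 2) * ∑ t ∈ Z, ‖u t‖ ^ 2))
    (Z : Finset G) (B : G → G → ℂ) (p q : G → ℝ)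
    (hB : ∀ w u : G → ℂ, (∑ t ∈ Z, ∑ s ∈ Z, B t s * w s * conj (u t)).re ≤
        ∑ s ∈ Z, p s * ‖w s‖ ^ 2 + ∑ t ∈ Z, q t * ‖u t‖ ^ 2) :
    (∑ t ∈ Z, ∑ s ∈ Z, B t s * k t s).re ≤ C * (∑ s ∈ Z, p s + ∑ t ∈ Z, q t) := by
  classical
  have hp : ∀ s ∈ Z, 0 ≤ p s := fun s hs => by
    simpa [Pi.single_apply, ite_pow, hs, apply_ite norm] using hB (Pi.single s 1) 0
  have hq : ∀ t ∈ Z, 0 ≤ q t := fun t ht => by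
    simpa [Pi.single_apply, ite_pow, ht, apply_ite norm] using hB 0 (Pi.single t 1)
  have hX : ∀ w u : G → ℂ, ‖∑ t ∈ Z, ∑ s ∈ Z, B t s * w s * conj (u t)‖ ^ 2 ≤
      4 * ((∑ s ∈ Z, p s * ‖w s‖ ^ 2) * ∑ t ∈ Z, q t * ‖u t‖ ^ 2) := by
    intro w u
    set X := ∑ t ∈ Z, ∑ s ∈ Z, B t s * w s * conj (u t) with hXdef
    set P := ∑ s ∈ Z, p s * ‖w s‖ ^ 2 with hP
    set Q := ∑ t ∈ Z, q t * ‖u t‖ ^ 2 with hQ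
    have hP0 : 0 ≤ P := Finset.sum_nonneg fun s hs => mul_nonneg (hp s hs) (sq_nonneg _)
    have hQ0 : 0 ≤ Q := Finset.sum_nonneg fun s hs => mul_nonneg (hq s hs) (sq_nonneg _)
    -- Replacing `w` by `r X̄ w` turns the domination inequality into a quadratic inequality in `r`;
    -- its discriminant yields `‖X‖² ≤ 4PQ`.
    have h : ∀ r : ℝ, 0 ≤ (‖X‖ ^ 2 * P) * (r * r) + (-‖X‖ ^ 2) * r + Q := by
      intro r
      have h1 := hB (fun s => (r : ℂ) * conj X * w s) u
      have h2 : ∑ t ∈ Z, ∑ s ∈ Z, B t s * ((r : ℂ) * conj X * w s) * conj (u t) =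
          ((r * ‖X‖ ^ 2 : ℝ) : ℂ) := by
        have : ((r * ‖X‖ ^ 2 : ℝ) : ℂ) = (r : ℂ) * conj X * X := by
          rw [mul_assoc, Complex.conj_mul']; push_cast; ring
        rw [this, hXdef, Finset.mul_sum]
        refine Finset.sum_congr rfl fun t _ => ?_
        rw [Finset.mul_sum]
        exact Finset.sum_congr rfl fun s _ => by ring
      have h3 : ∑ s ∈ Z, p s * ‖(r : ℂ) * conj X * w s‖ ^ 2 = ‖X‖ ^ 2 * P * (r * r) := by
        rw [hP, Finset.mul_sum, Finset.sum_mul]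
        refine Finset.sum_congr rfl fun s _ => ?_
        rw [norm_mul, norm_mul, RCLike.norm_conj, mul_pow, mul_pow, Complex.norm_real,
          Real.norm_eq_abs, sq_abs]
        ring
      rw [h2, h3, Complex.ofReal_re] at h1
      linarith
    have h4 := discrim_le_zero h
    rw [discrim] at h4
    by_cases hX0 : ‖X‖ ^ 2 = 0
    · rw [hX0]; positivity
    · have : 0 < ‖X‖ ^ 2 := lt_of_le_of_ne (sq_nonneg _) (Ne.symm hX0)
      nlinarith
  have hB0 : ∀ s ∈ Z, ∀ t ∈ Z, ‖B t s‖ ^ 2 ≤ 4 * (p s * q t) := fun s hs t ht => by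
    have h := hX (Pi.single s 1) (Pi.single t 1)
    simpa [Pi.single_apply, ite_pow, hs, ht, apply_ite norm, apply_ite conj] using h
  -- The contraction in `B t s = 2 √(q t) a t s √(p s)`. Where a weight vanishes, `a` is `0` by
  -- division by zero, and `B` vanishes there too by `hB0`.
  let a : G → G → ℂ := fun t s => B t s / (2 * √(p s) * √(q t) : ℝ)
  have ha : ∀ s ∈ Z, ∀ t ∈ Z, 2 * (a t s * (√(p s) : ℂ) * (√(q t) : ℂ)) = B t s := by
    intro s hs t ht
    simp only [a]
    by_cases h : √(p s) * √(q t) = 0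
    · have h1 : p s * q t = 0 := by
        rcases mul_eq_zero.1 h with h | h
        · rw [(Real.sqrt_eq_zero (hp s hs)).1 h, zero_mul]
        · rw [(Real.sqrt_eq_zero (hq t ht)).1 h, mul_zero]
      have h2 := hB0 s hs t ht
      rw [h1, mul_zero] at h2
      have h3 : B t s = 0 := norm_eq_zero.1 (pow_eq_zero_iff two_ne_zero |>.1
        (le_antisymm h2 (sq_nonneg _)))
      simp [h3]
    · obtain ⟨h1, h2⟩ := mul_ne_zero_iff.1 h
      have h1' : (√(p s) : ℂ) ≠ 0 := by exact_mod_cast h1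
      have h2' : (√(q t) : ℂ) ≠ 0 := by exact_mod_cast h2
      push_cast
      field_simp
  have hdiv : ∀ (r : ℝ) (z : ℂ), 0 ≤ r → r * ‖z / (√r : ℂ)‖ ^ 2 ≤ ‖z‖ ^ 2 := by
    intro r z hr
    rw [norm_div, Complex.norm_real, Real.norm_eq_abs, div_pow, sq_abs, Real.sq_sqrt hr]
    by_cases h : r = 0
    · simp [h]
    · exact (mul_div_cancel₀ _ h).le
  have hcontr : ∀ w u : G → ℂ, ‖∑ t ∈ Z, ∑ s ∈ Z, a t s * w s * conj (u t)‖ ^ 2 ≤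
        (∑ s ∈ Z, ‖w s‖ ^ 2) * ∑ t ∈ Z, ‖u t‖ ^ 2 := by
    intro w u
    have h1 := hX (fun s => w s / (√(p s) : ℂ)) (fun t => u t / (√(q t) : ℂ))
    have h2 : ∑ t ∈ Z, ∑ s ∈ Z, B t s * (w s / (√(p s) : ℂ)) * conj (u t / (√(q t) : ℂ)) =
        2 * ∑ t ∈ Z, ∑ s ∈ Z, a t s * w s * conj (u t) := by
      rw [Finset.mul_sum]
      refine Finset.sum_congr rfl fun t _ => ?_
      rw [Finset.mul_sum]
      refine Finset.sum_congr rfl fun s _ => ?_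
      simp only [a, map_div₀, Complex.conj_ofReal]
      push_cast
      ring
    rw [h2, norm_mul, mul_pow, Complex.norm_two] at h1
    have h3 : ∑ s ∈ Z, p s * ‖w s / (√(p s) : ℂ)‖ ^ 2 ≤ ∑ s ∈ Z, ‖w s‖ ^ 2 :=
      Finset.sum_le_sum fun s hs => hdiv _ _ (hp s hs)
    have h4 : ∑ s ∈ Z, q s * ‖u s / (√(q s) : ℂ)‖ ^ 2 ≤ ∑ s ∈ Z, ‖u s‖ ^ 2 :=
      Finset.sum_le_sum fun s hs => hdiv _ _ (hq s hs)
    have h5 := mul_le_mul h3 h4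
      (Finset.sum_nonneg fun s hs => mul_nonneg (hq s hs) (sq_nonneg _))
      (Finset.sum_nonneg fun s _ => sq_nonneg _)
    linarith
  have key := hk Z a hcontr (fun s => (√(p s) : ℂ)) (fun t => (√(q t) : ℂ))
  have e1 : ∑ t ∈ Z, ∑ s ∈ Z, B t s * k t s =
      2 * ∑ t ∈ Z, ∑ s ∈ Z, a t s * k t s * (√(p s) : ℂ) * conj (√(q t) : ℂ) := by
    rw [Finset.mul_sum]
    refine Finset.sum_congr rfl fun t ht => ?_
    rw [Finset.mul_sum]
    refine Finset.sum_congr rfl fun s hs => ?_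
    rw [← ha s hs t ht, Complex.conj_ofReal]
    ring
  have e2 : ∑ s ∈ Z, ‖(√(p s) : ℂ)‖ ^ 2 = ∑ s ∈ Z, p s :=
    Finset.sum_congr rfl fun s hs => by
      rw [Complex.norm_real, Real.norm_eq_abs, sq_abs, Real.sq_sqrt (hp s hs)]
  have e3 : ∑ s ∈ Z, ‖(√(q s) : ℂ)‖ ^ 2 = ∑ s ∈ Z, q s :=
    Finset.sum_congr rfl fun s hs => by
      rw [Complex.norm_real, Real.norm_eq_abs, sq_abs, Real.sq_sqrt (hq s hs)]
  rw [e2, e3] at key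
  have hP : 0 ≤ ∑ s ∈ Z, p s := Finset.sum_nonneg hp
  have hQ : 0 ≤ ∑ s ∈ Z, q s := Finset.sum_nonneg hq
  refine (Complex.re_le_norm _).trans (abs_le_of_sq_le_sq' ?_ (by positivity)).2
  rw [e1, norm_mul, mul_pow, Complex.norm_two]
  -- With `P`, `Q` the two sums of weights, this is `4 C² P Q ≤ C² (P + Q)²`.
  nlinarith [mul_nonneg (sq_nonneg C) (sq_nonneg (∑ s ∈ Z, p s - ∑ s ∈ Z, q s))]

/-! ### Weakly continuous vector functions -/

section Weak

variable {X H : Type*} [TopologicalSpace X] [NormedAddCommGroup H] [InnerProductSpace ℂ H]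

/-- Since `F` is bounded, norm approximation of `v` makes the functions `⟨w n, F x⟩` converge
uniformly in `x`. -/
theorem continuous_inner_of_mem_closure_span {F : X → H} {a : ℝ} (ha : ∀ x, ‖F x‖ ≤ a) {S : Set H}
    (hS : ∀ w ∈ S, Continuous fun x => inner ℂ w (F x)) {v : H}
    (hv : v ∈ (Submodule.span ℂ S).topologicalClosure) : Continuous fun x => inner ℂ v (F x) := by
  have hspan : ∀ w ∈ Submodule.span ℂ S, Continuous fun x => inner ℂ w (F x) := by
    intro w hw
    induction hw using Submodule.span_induction with
    | mem w hw => exact hS w hw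
    | zero => simpa using continuous_const
    | add v w _ _ hv hw => simp only [inner_add_left]; exact hv.add hw
    | smul c w _ hw => simp only [inner_smul_left]; exact continuous_const.mul hw
  obtain ⟨w, hw, hlim⟩ := mem_closure_iff_seq_limit.1 hv
  have hu : TendstoUniformly (fun n x => inner ℂ (w n) (F x)) (fun x => inner ℂ v (F x))
      Filter.atTop := by
    rw [Metric.tendstoUniformly_iff]
    intro ε hε
    have h1 : Filter.Tendsto (fun n => ‖v - w n‖ * a) Filter.atTop (nhds 0) := by
      have := (tendsto_const_nhds (x := v)).sub hlim
      simpa using this.norm.mul_const a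
    filter_upwards [h1.eventually (gt_mem_nhds hε)] with n hn x
    rw [dist_eq_norm, ← inner_sub_left]
    exact ((norm_inner_le_norm _ _).trans (mul_le_mul_of_nonneg_left (ha x) (norm_nonneg _))).trans_lt
      hn
  exact hu.continuous (Filter.Eventually.of_forall fun n => hspan _ (hw n)).frequently

/-- The vectors in a bounded factorization of a separately continuous kernel may be taken weakly
continuous. -/
theorem exists_weaklyContinuous_gram [CompleteSpace H] {k : X → X → ℂ} {ξ η : X → H} {a b : ℝ}
    (hξ : ∀ s, ‖ξ s‖ ≤ a) (hη : ∀ t, ‖η t‖ ≤ b) (hk : ∀ s t, inner ℂ (η t) (ξ s) = k t s)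
    (h₁ : ∀ t, Continuous fun s => k t s) (h₂ : ∀ s, Continuous fun t => k t s) :
    ∃ ξ' η' : X → H, (∀ s, ‖ξ' s‖ ≤ a) ∧ (∀ t, ‖η' t‖ ≤ b) ∧
      (∀ s t, inner ℂ (η' t) (ξ' s) = k t s) ∧ (∀ v, Continuous fun s => inner ℂ v (ξ' s)) ∧
      ∀ v, Continuous fun t => inner ℂ v (η' t) := by
  -- Projecting `ξ` onto the closed span of `η` leaves every pairing unchanged, and a test vector
  -- then matters only through its projection to that span, where continuity comes from `k`.
  -- Afterwards `η` is projected onto the closed span of the new `ξ'`, so the pairings survive once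
  -- more.
  let E₁ := (Submodule.span ℂ (Set.range η)).topologicalClosure
  have : CompleteSpace E₁ := (Submodule.isClosed_topologicalClosure _).completeSpace_coe
  let ξ' : X → H := fun s => E₁.starProjection (ξ s)
  let E₂ := (Submodule.span ℂ (Set.range ξ')).topologicalClosure
  have : CompleteSpace E₂ := (Submodule.isClosed_topologicalClosure _).completeSpace_coe
  let η' : X → H := fun t => E₂.starProjection (η t)
  have k₁ : ∀ s t, inner ℂ (η t) (ξ' s) = k t s := fun s t => by
    rw [← hk, ← Submodule.inner_starProjection_left_eq_right]
    rw [Submodule.starProjection_eq_self_iff.2]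
    exact Submodule.le_topologicalClosure _ (Submodule.subset_span ⟨t, rfl⟩)
  have k₂ : ∀ s t, inner ℂ (η' t) (ξ' s) = k t s := fun s t => by
    rw [← k₁, Submodule.inner_starProjection_left_eq_right]
    rw [Submodule.starProjection_eq_self_iff.2]
    exact Submodule.le_topologicalClosure _ (Submodule.subset_span ⟨s, rfl⟩)
  refine ⟨ξ', η', fun s => (E₁.norm_starProjection_apply_le _).trans (hξ s),
    fun s => (E₂.norm_starProjection_apply_le _).trans (hη s), k₂, fun v => ?_, fun v => ?_⟩
  · simp only [ξ', ← Submodule.inner_starProjection_left_eq_right]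
    refine continuous_inner_of_mem_closure_span hξ ?_ (Submodule.starProjection_apply_mem _ v)
    rintro _ ⟨t, rfl⟩
    simpa only [hk] using h₁ t
  · simp only [η', ← Submodule.inner_starProjection_left_eq_right]
    refine continuous_inner_of_mem_closure_span hη ?_ (Submodule.starProjection_apply_mem _ v)
    rintro _ ⟨s, rfl⟩
    have := (h₂ s).star
    refine this.congr fun t => ?_
    rw [← k₁, ← inner_conj_symm, ← starRingEnd_apply, Complex.conj_conj]

end Weak

/-! ### Amplifications and normal functionals -/

section Amplification

variable {ι κ H K : Type*} [NormedAddCommGroup H] [InnerProductSpace ℂ H] [CompleteSpace H]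
  [NormedAddCommGroup K] [InnerProductSpace ℂ K] [CompleteSpace K]

theorem memℓp_two {f : ι → H} (h : Summable fun i => ‖f i‖ ^ 2) : Memℓp f 2 :=
  memℓp_gen (h.congr fun i => by simp)

theorem hasSum_norm_sq (x : lp (fun _ : ι => H) 2) : HasSum (fun i => ‖x i‖ ^ 2) (‖x‖ ^ 2) := by
  have h := (lp.hasSum_inner (𝕜 := ℂ) x x).mapL Complex.reCLM
  have e2 : Complex.reCLM (inner ℂ x x) = ‖x‖ ^ 2 := inner_self_eq_norm_sq (𝕜 := ℂ) x
  rw [e2] at h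
  exact h.congr_fun fun i => (inner_self_eq_norm_sq (𝕜 := ℂ) (x i)).symm

/-- A square summable family of operators defines an operator into `ℓ²(ι, K)`. -/
theorem exists_columnOp (A : ι → H →L[ℂ] K) {a : ℝ} (ha : 0 ≤ a)
    (hA : ∀ x (s : Finset ι), ∑ i ∈ s, ‖A i x‖ ^ 2 ≤ (a * ‖x‖) ^ 2) :
    ∃ V : H →L[ℂ] lp (fun _ : ι => K) 2, (∀ x, ‖V x‖ ≤ a * ‖x‖) ∧ ∀ x i, V x i = A i x := by
  have hm : ∀ x, Memℓp (fun i => A i x) 2 := fun x =>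
    memℓp_two (summable_of_sum_le (fun i => sq_nonneg _) (hA x))
  let f : H →ₗ[ℂ] lp (fun _ : ι => K) 2 :=
    { toFun := fun x => ⟨fun i => A i x, hm x⟩
      map_add' := fun x y => by ext i; exact map_add (A i) x y
      map_smul' := fun c x => by ext i; exact map_smul (A i) c x }
  have hf : ∀ x, ‖f x‖ ≤ a * ‖x‖ := fun x => by
    refine lp.norm_le_of_forall_sum_le (by simp) (by positivity) fun s => ?_
    simpa [f] using hA x s
  exact ⟨f.mkContinuous a hf, hf, fun x i => rfl⟩

theorem exists_amplify (ι : Type*) (T : H →L[ℂ] H) :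
    ∃ V : lp (fun _ : ι => H) 2 →L[ℂ] lp (fun _ : ι => H) 2,
      (∀ x, ‖V x‖ ≤ ‖T‖ * ‖x‖) ∧ ∀ x i, V x i = T (x i) :=
  exists_columnOp (fun i => T ∘L lp.evalCLM ℂ (fun _ : ι => H) 2 i) (norm_nonneg T)
    fun x s => by
      rw [mul_pow, ← (hasSum_norm_sq x).tsum_eq, ← tsum_mul_left]
      refine (Finset.sum_le_sum fun i _ => ?_).trans
        (((hasSum_norm_sq x).summable.mul_left (‖T‖ ^ 2)).sum_le_tsum s
          fun i _ => by positivity)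
      rw [← mul_pow]
      exact pow_le_pow_left₀ (norm_nonneg _) (T.le_opNorm (x i)) 2

/-- The diagonal amplification of `T` to `ℓ²(ι, H)`. -/
noncomputable def amplify (ι : Type*) (T : H →L[ℂ] H) :
    lp (fun _ : ι => H) 2 →L[ℂ] lp (fun _ : ι => H) 2 :=
  (exists_amplify ι T).choose

theorem amplify_apply (T : H →L[ℂ] H) (x : lp (fun _ : ι => H) 2) (i : ι) :
    amplify ι T x i = T (x i) :=
  (exists_amplify ι T).choose_spec.2 x i

theorem hasSum_inner_amplify (T : H →L[ℂ] H) (x y : lp (fun _ : ι => H) 2) :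
    HasSum (fun i => inner ℂ (y i) (T (x i))) (inner ℂ y (amplify ι T x)) := by
  simpa only [amplify_apply] using lp.hasSum_inner (𝕜 := ℂ) y (amplify ι T x)

theorem amplify_mul (S T : H →L[ℂ] H) (x : lp (fun _ : ι => H) 2) :
    amplify ι (S * T) x = amplify ι S (amplify ι T x) := by
  ext i; simp only [amplify_apply]; rfl

theorem amplify_smul (c : ℂ) (T : H →L[ℂ] H) (x : lp (fun _ : ι => H) 2) :
    amplify ι (c • T) x = c • amplify ι T x := by
  ext i; simp only [amplify_apply, lp.coeFn_smul, Pi.smul_apply, smul_apply]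

theorem inner_amplify_star (T : H →L[ℂ] H) (x y : lp (fun _ : ι => H) 2) :
    inner ℂ (amplify ι (star T) y) x = inner ℂ y (amplify ι T x) := by
  rw [lp.inner_eq_tsum, lp.inner_eq_tsum]
  simp only [amplify_apply]
  exact tsum_congr fun i => ContinuousLinearMap.adjoint_inner_left T (x i) (y i)

theorem norm_amplify_of_isometry {T : H →L[ℂ] H} (hT : ∀ x, ‖T x‖ = ‖x‖)
    (x : lp (fun _ : ι => H) 2) : ‖amplify ι T x‖ = ‖x‖ := by
  have h := hasSum_norm_sq (amplify ι T x)
  simp only [amplify_apply, hT] at h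
  exact (pow_left_inj₀ (norm_nonneg _) (norm_nonneg _) two_ne_zero).1
    (h.unique (hasSum_norm_sq x))

/-- Dominated convergence for the sum over `ι`, with dominating terms `4 ‖x i‖²` because each
difference has norm at most `2 ‖x i‖`. -/
theorem continuous_amplify {X : Type*} [TopologicalSpace X] {U : X → H →L[ℂ] H}
    (hU : ∀ s x, ‖U s x‖ = ‖x‖) (hc : ∀ x, Continuous fun s => U s x)
    (x : lp (fun _ : ι => H) 2) : Continuous fun s => amplify ι (U s) x := by
  refine continuous_iff_continuousAt.2 fun s₀ => ?_
  rw [ContinuousAt, tendsto_iff_norm_sub_tendsto_zero]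
  have h1 : ∀ s, ‖amplify ι (U s) x - amplify ι (U s₀) x‖ ^ 2 =
      ∑' i, ‖U s (x i) - U s₀ (x i)‖ ^ 2 := fun s => by
    rw [← (hasSum_norm_sq _).tsum_eq]
    simp only [lp.coeFn_sub, Pi.sub_apply, amplify_apply]
  have h2 : Filter.Tendsto (fun s => ∑' i, ‖U s (x i) - U s₀ (x i)‖ ^ 2) (nhds s₀)
      (nhds (∑' i : ι, (0 : ℝ))) := by
    refine tendsto_tsum_of_dominated_convergence ((hasSum_norm_sq x).summable.mul_left 4)
      (fun i => ?_) (Filter.Eventually.of_forall fun s i => ?_)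
    · have h := ((hc (x i)).tendsto s₀).sub_const (U s₀ (x i))
      rw [sub_self] at h
      simpa using h.norm.pow 2
    · rw [Real.norm_eq_abs, abs_of_nonneg (sq_nonneg _)]
      have h := norm_sub_le (U s (x i)) (U s₀ (x i))
      rw [hU, hU] at h
      nlinarith [norm_nonneg (U s (x i) - U s₀ (x i)), norm_nonneg (x i)]
  rw [tsum_zero] at h2
  have h3 := h2.sqrt
  simpa only [← h1, Real.sqrt_sq (norm_nonneg _), Real.sqrt_zero] using h3

/-- If `U` is strongly continuous and isometric, then `s ↦ U(s) x(s)` is continuous for continuous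
`x`. -/
theorem continuous_isometry_apply {X E : Type*} [TopologicalSpace X] [NormedAddCommGroup E]
    [NormedSpace ℂ E] {U : X → E →L[ℂ] E} (hU : ∀ s x, ‖U s x‖ = ‖x‖)
    (hc : ∀ x, Continuous fun s => U s x) {x : X → E} (hx : Continuous x) :
    Continuous fun s => U s (x s) := by
  refine continuous_iff_continuousAt.2 fun s₀ => ?_
  have h1 : Filter.Tendsto (fun s => U s (x s - x s₀)) (nhds s₀) (nhds 0) := by
    rw [tendsto_zero_iff_norm_tendsto_zero]
    simp only [hU]
    rw [← tendsto_iff_norm_sub_tendsto_zero]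
    exact hx.tendsto s₀
  have h2 := h1.add ((hc (x s₀)).tendsto s₀)
  simpa [ContinuousAt] using h2

/-- The definition of normal functionals uses sequences; summability forces countable support, so
any index type reduces to `ℕ`. This is needed because Hilbert bases here may be uncountable. -/
theorem exists_predual (M : VonNeumannAlgebra H) (x y : κ → H)
    (h : Summable fun j => ‖x j‖ * ‖y j‖) : ∃ ψ : Predual M, ∀ T : M.toStarSubalgebra,
      HasSum (fun j => inner ℂ (y j) ((T : H →L[ℂ] H) (x j))) (Predual.pairing M ψ T) := by
  let S : Set κ := Function.support fun j => ‖x j‖ * ‖y j‖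
  have hS : S.Countable := h.countable_support
  have := hS.to_subtype
  obtain ⟨f, hf⟩ := exists_injective_nat S
  let x' : ℕ → H := Function.extend f (fun j => x j) 0
  let y' : ℕ → H := Function.extend f (fun j => y j) 0
  have hx' : ∀ j, x' (f j) = x j := fun j => hf.extend_apply _ _ j
  have hy' : ∀ j, y' (f j) = y j := fun j => hf.extend_apply _ _ j
  have hx0 : ∀ n, n ∉ Set.range f → x' n = 0 := fun n hn =>
    Function.extend_apply' _ _ _ fun ⟨j, hj⟩ => hn ⟨j, hj⟩
  have hsum : Summable fun n => ‖x' n‖ * ‖y' n‖ := by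
    rw [← hf.summable_iff fun n hn => by simp [hx0 n hn]]
    simp only [Function.comp_def, hx', hy']
    exact h.subtype S
  have hT : ∀ T : H →L[ℂ] H, ∀ n, ‖inner ℂ (y' n) (T (x' n))‖ ≤ ‖T‖ * (‖x' n‖ * ‖y' n‖) :=
    fun T n => (norm_inner_le_norm _ _).trans (by
      nlinarith [mul_le_mul_of_nonneg_left (T.le_opNorm (x' n)) (norm_nonneg (y' n))])
  have hTs : ∀ T : H →L[ℂ] H, Summable fun n => inner ℂ (y' n) (T (x' n)) := fun T =>
    Summable.of_norm_bounded (hsum.mul_left ‖T‖) (hT T)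
  let ψ : M.toStarSubalgebra →ₗ[ℂ] ℂ :=
    { toFun := fun T => ∑' n, inner ℂ (y' n) ((T : H →L[ℂ] H) (x' n))
      map_add' := fun S T => by
        rw [← (hTs S).tsum_add (hTs T)]
        exact tsum_congr fun n => inner_add_right _ _ _
      map_smul' := fun c T => by
        rw [smul_eq_mul, RingHom.id_apply, ← tsum_mul_left]
        exact tsum_congr fun n => inner_smul_right _ _ _ }
  refine ⟨⟨ψ, x', y', hsum, fun T => (hTs T).hasSum⟩, fun T => ?_⟩
  have h1 : HasSum (fun n => inner ℂ (y' n) ((T : H →L[ℂ] H) (x' n))) (ψ T) := (hTs T).hasSum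
  rw [← hf.hasSum_iff fun n hn => by simp [hx0 n hn]] at h1
  simp only [Function.comp_def, hx', hy'] at h1
  refine (hasSum_subtype_iff_of_support_subset (s := S) fun j hj => ?_).1 h1
  simp only [Function.mem_support] at hj
  simp only [S, Function.mem_support]
  intro h0
  rcases mul_eq_zero.1 h0 with h0 | h0 <;> simp [norm_eq_zero.1 h0] at hj

theorem exists_hasSum_pairing {M : VonNeumannAlgebra H} (ψ : Predual M) :
    ∃ x y : ℕ → H, Summable (fun n => ‖x n‖ * ‖y n‖) ∧ ∀ T : M.toStarSubalgebra,
      HasSum (fun n => inner ℂ (y n) ((T : H →L[ℂ] H) (x n))) (Predual.pairing M ψ T) :=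
  ψ.2

theorem exists_predual_vector (M : VonNeumannAlgebra H) (x y : H) : ∃ ψ : Predual M,
    ∀ T : M.toStarSubalgebra, Predual.pairing M ψ T = inner ℂ y ((T : H →L[ℂ] H) x) := by
  obtain ⟨ψ, h⟩ := exists_predual M (fun _ : Unit => x) (fun _ => y) (hasSum_fintype _).summable
  exact ⟨ψ, fun T => (h T).unique (hasSum_unique _)⟩

end Amplification

/-! ### Operators on `L²(G)` -/

section L2

variable {G : Type u} [TopologicalSpace G] [MeasurableSpace G] [BorelSpace G] {μ : Measure G}

theorem norm_sq_eq_integral (f : Lp ℂ 2 μ) : ‖f‖ ^ 2 = ∫ t, ‖f t‖ ^ 2 ∂μ := by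
  have h := L2.inner_def (𝕜 := ℂ) f f
  simp only [inner_self_eq_norm_sq_to_K] at h
  have h2 : ((‖f‖ ^ 2 : ℝ) : ℂ) = ((∫ t, ‖f t‖ ^ 2 ∂μ : ℝ) : ℂ) := by
    rw [← integral_complex_ofReal]
    push_cast
    exact h
  exact_mod_cast h2

theorem integrable_norm_sq (f : Lp ℂ 2 μ) : Integrable (fun t => ‖f t‖ ^ 2) μ :=
  (memLp_two_iff_integrable_sq_norm (Lp.aestronglyMeasurable f)).1 (Lp.memLp f)

/-- Multiplication by a bounded continuous function. -/
theorem exists_mulOp {g : G → ℂ} (hg : Continuous g) {c : ℝ} (hc : ∀ t, ‖g t‖ ≤ c) :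
    ∃ A : Lp ℂ 2 μ →L[ℂ] Lp ℂ 2 μ, ∀ x : Lp ℂ 2 μ, A x =ᵐ[μ] fun t => g t * x t := by
  have hm : ∀ x : Lp ℂ 2 μ, MemLp (fun t => g t * x t) 2 μ := fun x =>
    (Lp.memLp x).of_le_mul (c := c) (hg.aestronglyMeasurable.mul (Lp.aestronglyMeasurable x))
      (Filter.Eventually.of_forall fun t => by
        rw [norm_mul]; exact mul_le_mul_of_nonneg_right (hc t) (norm_nonneg _))
  let f : Lp ℂ 2 μ →ₗ[ℂ] Lp ℂ 2 μ :=
    { toFun := fun x => (hm x).toLp _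
      map_add' := fun x y => by
        rw [← MemLp.toLp_add]
        refine MemLp.toLp_congr _ _ ?_
        filter_upwards [Lp.coeFn_add x y] with t ht
        simp only [ht, Pi.add_apply, mul_add]
      map_smul' := fun a x => by
        rw [RingHom.id_apply, ← MemLp.toLp_const_smul]
        refine MemLp.toLp_congr _ _ ?_
        filter_upwards [Lp.coeFn_smul a x] with t ht
        simp only [ht, Pi.smul_apply, smul_eq_mul]
        ring }
  refine ⟨f.mkContinuous c fun x => Lp.norm_le_mul_norm_of_ae_le_mul ?_,
    fun x => MemLp.coeFn_toLp (hm x)⟩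
  filter_upwards [MemLp.coeFn_toLp (hm x)] with t ht
  show ‖((hm x).toLp _ : Lp ℂ 2 μ) t‖ ≤ _
  rw [ht, norm_mul]
  exact mul_le_mul_of_nonneg_right (hc t) (norm_nonneg _)

variable {ι H : Type*} [NormedAddCommGroup H] [InnerProductSpace ℂ H]

/-- A bounded weakly continuous function `F : G → H` defines the operator `x ↦ x F` from `L²(G)` to
`L²(G) ⊗ H`. -/
theorem exists_weakColumnOp (b : HilbertBasis ι ℂ H) {F : G → H}
    (hF : ∀ v, Continuous fun t => inner ℂ v (F t)) {a : ℝ} (h0 : 0 ≤ a) (ha : ∀ t, ‖F t‖ ≤ a) :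
    ∃ V : Lp ℂ 2 μ →L[ℂ] lp (fun _ : ι => Lp ℂ 2 μ) 2, (∀ x, ‖V x‖ ≤ a * ‖x‖) ∧
      ∀ x i, V x i =ᵐ[μ] fun t => inner ℂ (b i) (F t) * x t := by
  have hb : ∀ i t, ‖inner ℂ (b i) (F t)‖ ≤ a := fun i t =>
    (norm_inner_le_norm _ _).trans (by rw [b.orthonormal.1 i, one_mul]; exact ha t)
  choose A hA using fun i => exists_mulOp (μ := μ) (hF (b i)) (hb i)
  obtain ⟨V, hV1, hV2⟩ := exists_columnOp A h0 fun x s => by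
    have h1 : ∀ i, ‖A i x‖ ^ 2 = ∫ t, ‖inner ℂ (b i) (F t)‖ ^ 2 * ‖x t‖ ^ 2 ∂μ := fun i => by
      rw [norm_sq_eq_integral]
      refine integral_congr_ae ?_
      filter_upwards [hA i x] with t ht
      rw [ht, norm_mul, mul_pow]
    have h2 : ∀ i ∈ s, Integrable (fun t => ‖inner ℂ (b i) (F t)‖ ^ 2 * ‖x t‖ ^ 2) μ := by
      intro i _
      refine (integrable_norm_sq (A i x)).congr ?_
      filter_upwards [hA i x] with t ht
      rw [ht, norm_mul, mul_pow]
    simp only [h1]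
    rw [← integral_finsetSum s h2, mul_pow, norm_sq_eq_integral x, ← integral_const_mul]
    refine integral_mono (integrable_finsetSum s h2) ((integrable_norm_sq x).const_mul _) fun t => ?_
    simp only [← Finset.sum_mul]
    refine mul_le_mul_of_nonneg_right ?_ (sq_nonneg _)
    exact (b.orthonormal.sum_inner_products_le (F t)).trans
      (pow_le_pow_left₀ (norm_nonneg _) (ha t) 2)
  exact ⟨V, hV1, fun x i => by rw [hV2]; exact hA i x⟩

/-- On an open set of finite measure, all but countably many coordinates of a bounded weakly
continuous function vanish. -/
theorem countable_coordinates [μ.IsOpenPosMeasure] (b : HilbertBasis ι ℂ H) {F : G → H}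
    (hF : ∀ v, Continuous fun t => inner ℂ v (F t)) {a : ℝ} (ha : ∀ t, ‖F t‖ ≤ a)
    {U : Set G} (hU : IsOpen U) (hμ : μ U < ∞) :
    {i | ∃ t ∈ U, inner ℂ (b i) (F t) ≠ 0}.Countable := by
  -- Bessel's inequality under the integral. A coordinate with zero integral over `U` vanishes on
  -- all of `U`, being continuous and the measure being positive on nonempty open sets.
  have hsum : ∑' i, ∫⁻ t in U, ‖inner ℂ (b i) (F t)‖ₑ ^ 2 ∂μ ≠ ∞ := by
    refine ne_top_of_le_ne_top (b := ENNReal.ofReal (a ^ 2) * μ U)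
      (ENNReal.mul_ne_top ENNReal.ofReal_ne_top hμ.ne) ?_
    rw [ENNReal.tsum_eq_iSup_sum]
    refine iSup_le fun s => ?_
    rw [← lintegral_finsetSum s fun i _ => ((hF (b i)).measurable.enorm.pow_const 2)]
    refine (lintegral_mono (g := fun _ => ENNReal.ofReal (a ^ 2)) fun t => ?_).trans
      (by rw [setLIntegral_const])
    have h1 : ∀ i, ‖inner ℂ (b i) (F t)‖ₑ ^ 2 = ENNReal.ofReal (‖inner ℂ (b i) (F t)‖ ^ 2) :=
      fun i => by rw [ENNReal.ofReal_pow (norm_nonneg _), ofReal_norm]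
    simp only [h1]
    rw [← ENNReal.ofReal_sum_of_nonneg fun i _ => sq_nonneg _]
    exact ENNReal.ofReal_le_ofReal ((b.orthonormal.sum_inner_products_le (F t)).trans
      (pow_le_pow_left₀ (norm_nonneg _) (ha t) 2))
  refine (Summable.countable_support_ennreal hsum).mono ?_
  rintro i ⟨t, htU, ht⟩ h0
  rw [lintegral_eq_zero_iff ((hF (b i)).measurable.enorm.pow_const 2)] at h0
  have h1 : ∀ᵐ t ∂μ, t ∈ U → inner ℂ (b i) (F t) = 0 := by
    rw [← ae_restrict_iff' hU.measurableSet]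
    filter_upwards [h0] with t ht
    simpa using ht
  have h2 : μ (U ∩ {t | inner ℂ (b i) (F t) ≠ 0}) = 0 := by
    rw [ae_iff] at h1
    convert h1 using 2
    ext t
    simp
  have hO : IsOpen (U ∩ {t | inner ℂ (b i) (F t) ≠ 0}) :=
    hU.inter (isOpen_ne_fun (hF (b i)) continuous_const)
  exact ((hO.measure_eq_zero_iff (μ := μ)).1 h2).subset ⟨htU, ht⟩

/-- The set where `y` is nonzero is a countable union of level sets of finite measure, each inside
an open set of finite measure by outer regularity. Sums over a possibly uncountable basis can
thereby be exchanged with integrals. -/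
theorem countable_coordinates_of_Lp [μ.IsOpenPosMeasure] [μ.OuterRegular] (b : HilbertBasis ι ℂ H)
    {F : G → H} (hF : ∀ v, Continuous fun t => inner ℂ v (F t)) {a : ℝ} (ha : ∀ t, ‖F t‖ ≤ a)
    (y : Lp ℂ 2 μ) :
    ∃ I : Set ι, I.Countable ∧ ∀ i ∉ I, ∀ t, inner ℂ (b i) (F t) * y t = 0 := by
  have hfin : ∀ n : ℕ, μ {t | ((n : NNReal) + 1)⁻¹ ≤ ‖y t‖₊} < ∞ := fun n =>
    (Lp.memLp y).meas_ge_lt_top (by simp) (by simp) (by positivity)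
  choose U hU1 hU2 hU3 using fun n => Set.exists_isOpen_lt_of_lt _ _ (hfin n)
  refine ⟨⋃ n, {i | ∃ t ∈ U n, inner ℂ (b i) (F t) ≠ 0},
    Set.countable_iUnion fun n => countable_coordinates b hF ha (hU2 n) (hU3 n), fun i hi t => ?_⟩
  by_cases hy : y t = 0
  · rw [hy, mul_zero]
  · have hpos : 0 < ‖y t‖ := norm_pos_iff.2 hy
    obtain ⟨n, hn⟩ := exists_nat_one_div_lt hpos
    have ht : t ∈ U n := hU1 n (by
      show ((n : NNReal) + 1)⁻¹ ≤ ‖y t‖₊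
      rw [← NNReal.coe_le_coe]
      push_cast
      rw [← one_div]
      exact hn.le)
    by_contra h
    exact hi (Set.mem_iUnion.2 ⟨n, t, ht, left_ne_zero_of_mul h⟩)

end L2

/-! ### Strong continuity of the twisted regular representation -/

section Rep

variable {G : Type u} [Group G] [TopologicalSpace G] [IsTopologicalGroup G]
  [MeasurableSpace G] [BorelSpace G] {μ : Measure G} [μ.IsHaarMeasure]

theorem exists_norm_one [LocallyCompactSpace G] [T2Space G] : ∃ x : Lp ℂ 2 μ, ‖x‖ = 1 := by
  obtain ⟨K, hK, hK1⟩ := exists_compact_mem_nhds (1 : G)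
  have hpos : 0 < μ K := Measure.measure_pos_of_mem_nhds μ hK1
  let x : Lp ℂ 2 μ := indicatorConstLp 2 hK.isClosed.measurableSet hK.measure_lt_top.ne 1
  have hx : x ≠ 0 := by
    rw [← norm_ne_zero_iff, norm_indicatorConstLp (by simp) (by simp)]
    simp only [norm_one, one_mul]
    refine (Real.rpow_pos_of_pos ?_ _).ne'
    exact ENNReal.toReal_pos hpos.ne' hK.measure_lt_top.ne
  exact ⟨((‖x‖ : ℂ)⁻¹) • x, norm_smul_inv_norm hx⟩

/-- For `s` near `s₀` all the translates are supported in one compact set `L`, on which they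
converge uniformly; finiteness of `μ L` turns this into `L²` convergence. -/
theorem continuous_regularRep_toLp [LocallyCompactSpace G] (σ : ContTwoCocycle G) {f : G → ℂ}
    (hf : Continuous f) (hs : HasCompactSupport f) (hm : MemLp f 2 μ) :
    Continuous fun s => regularRep σ μ s (hm.toLp f) := by
  refine continuous_iff_continuousAt.2 fun s₀ => ?_
  let g : G → G → ℂ := fun s t => σ s (s⁻¹ * t) * f (s⁻¹ * t)
  have hg : Continuous fun p : G × G => g p.1 p.2 := by
    have h1 : Continuous fun p : G × G => p.1⁻¹ * p.2 := continuous_fst.inv.mul continuous_snd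
    exact (σ.continuous'.comp (continuous_fst.prodMk h1)).mul (hf.comp h1)
  have hrep : ∀ s, regularRep σ μ s (hm.toLp f) =ᵐ[μ] g s := fun s => by
    filter_upwards [regularRep_apply σ μ s (hm.toLp f),
      (measurePreserving_mul_left μ s⁻¹).quasiMeasurePreserving.ae_eq_comp hm.coeFn_toLp]
      with t h1 h2
    simp only [Function.comp_apply] at h2
    rw [h1, h2]
  obtain ⟨N, hN, hN1⟩ := exists_compact_mem_nhds s₀
  let L := N * tsupport f
  have hL : IsCompact L := hN.mul hs
  have hsupp : ∀ s ∈ N, ∀ t ∉ L, g s t = 0 := fun s hsN t ht => by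
    have : f (s⁻¹ * t) = 0 := by
      by_contra h
      exact ht ⟨s, hsN, s⁻¹ * t, subset_tsupport f h, mul_inv_cancel_left s t⟩
    simp only [g, this, mul_zero]
  have hunif : ∀ ε > 0, ∀ᶠ s in nhds s₀, ∀ t ∈ L, ‖g s t - g s₀ t‖ < ε := by
    intro ε hε
    refine hL.eventually_forall_of_forall_eventually fun t _ => ?_
    have hc : Continuous fun p : G × G => ‖g p.1 p.2 - g s₀ p.2‖ :=
      (hg.sub (hg.comp (continuous_const.prodMk continuous_snd))).norm
    refine hc.tendsto (s₀, t) |>.eventually (gt_mem_nhds ?_)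
    simpa using hε
  let c : ℝ := (μ L ^ (1 / (2 : ℝ≥0∞).toReal)).toReal
  have hμL : μ L ^ (1 / (2 : ℝ≥0∞).toReal) ≠ ∞ :=
    ENNReal.rpow_ne_top_of_nonneg (by simp) hL.measure_lt_top.ne
  rw [Metric.continuousAt_iff']
  intro ε hε
  have hc : 0 ≤ c := ENNReal.toReal_nonneg
  -- `c + 1` rather than `c`, which could be zero.
  have hδ : 0 < ε / (c + 1) := by positivity
  filter_upwards [hunif _ hδ, hN1] with s h1 hsN
  rw [dist_eq_norm, Lp.norm_def]
  have h2 : eLpNorm (⇑(regularRep σ μ s (hm.toLp f) - regularRep σ μ s₀ (hm.toLp f))) 2 μ ≤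
      ENNReal.ofReal (ε / (c + 1)) * μ L ^ (1 / (2 : ℝ≥0∞).toReal) := by
    have h3 : eLpNorm (⇑(regularRep σ μ s (hm.toLp f) - regularRep σ μ s₀ (hm.toLp f))) 2 μ ≤
        eLpNorm (L.indicator fun _ => ε / (c + 1)) 2 μ := by
      refine eLpNorm_mono_ae ?_
      filter_upwards [Lp.coeFn_sub (regularRep σ μ s (hm.toLp f)) (regularRep σ μ s₀ (hm.toLp f)),
        hrep s, hrep s₀] with t e1 e2 e3
      rw [e1, Pi.sub_apply, e2, e3]
      by_cases ht : t ∈ L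
      · rw [Set.indicator_of_mem ht, Real.norm_of_nonneg hδ.le]
        exact (h1 t ht).le
      · rw [hsupp s hsN t ht, hsupp s₀ (mem_of_mem_nhds hN1) t ht]
        simp
    refine h3.trans ((eLpNorm_indicator_const_le _ _).trans_eq ?_)
    rw [← ofReal_norm, Real.norm_of_nonneg hδ.le]
  refine (ENNReal.toReal_mono (ENNReal.mul_ne_top ENNReal.ofReal_ne_top hμL) h2).trans_lt ?_
  rw [ENNReal.toReal_mul, ENNReal.toReal_ofReal hδ.le]
  show ε / (c + 1) * c < ε
  rw [div_mul_eq_mul_div, div_lt_iff₀ (by positivity)]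
  nlinarith

/-- Density of the compactly supported continuous functions in `L²`, without normality of the
space. -/
theorem exists_hasCompactSupport_eLpNorm_sub_le {X : Type*} [TopologicalSpace X]
    [LocallyCompactSpace X] [RegularSpace X] [MeasurableSpace X] [BorelSpace X] {μ : Measure X}
    [μ.Regular] {f : X → ℂ} (hf : MemLp f 2 μ) {ε : ℝ≥0∞} (hε : ε ≠ 0) :
    ∃ g : X → ℂ, eLpNorm (f - g) 2 μ ≤ ε ∧ Continuous g ∧ MemLp g 2 μ ∧ HasCompactSupport g := by
  refine hf.induction_dense (by simp)
    (fun g => Continuous g ∧ MemLp g 2 μ ∧ HasCompactSupport g) ?_ ?_ ?_ hε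
  · intro c t ht htμ ε hε
    obtain ⟨δ, δpos, hδ⟩ := exists_Lp_half ℂ μ 2 hε
    obtain ⟨η, ηpos, hη⟩ := exists_eLpNorm_indicator_le (μ := μ) (p := 2) (by simp) c δpos.ne'
    have hη' : (η : ℝ≥0∞) ≠ 0 := by simpa using ηpos.ne'
    -- An indicator is approximated by that of a closed compact subset `s`, then by a compactly
    -- supported bump equal to `1` on `s` and vanishing off a slightly larger open `V`.
    obtain ⟨s, st, hs, hsc, μs⟩ := ht.exists_isCompact_isClosed_sdiff_lt htμ.ne hη'
    obtain ⟨V, sV, V_open, -, hV⟩ := hsc.measurableSet.exists_isOpen_sdiff_lt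
      (hs.measure_lt_top (μ := μ)).ne hη'
    obtain ⟨f, f1, f0, fs, fr⟩ := exists_continuous_one_zero_of_isCompact hs V_open.isClosed_compl
      (Set.disjoint_compl_right_iff_subset.2 sV)
    have hcont : Continuous fun x => (f x : ℂ) * c :=
      (Complex.continuous_ofReal.comp f.continuous).mul continuous_const
    have hcs : HasCompactSupport fun x => (f x : ℂ) * c := by
      refine HasCompactSupport.mul_right (f := fun x => (f x : ℂ)) ?_
      exact fs.comp_left (g := fun r : ℝ => (r : ℂ)) Complex.ofReal_zero
    have hb : ∀ x, ‖(f x : ℂ) * c‖ ≤ ‖c‖ := fun x => by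
      rw [norm_mul, Complex.norm_real, Real.norm_of_nonneg (fr x).1]
      exact mul_le_of_le_one_left (norm_nonneg _) (fr x).2
    have hmem : MemLp (fun x => (f x : ℂ) * c) 2 μ := by
      refine ⟨hcont.aestronglyMeasurable, ?_⟩
      refine (eLpNorm_mono (g := (tsupport fun x => (f x : ℂ) * c).indicator fun _ => c)
        fun x => ?_).trans_lt ((eLpNorm_indicator_const_le _ _).trans_lt
          (ENNReal.mul_lt_top (by simp) (ENNReal.rpow_lt_top_of_nonneg (by simp)
            hcs.measure_lt_top.ne)))
      by_cases hx : x ∈ tsupport fun x => (f x : ℂ) * c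
      · rw [Set.indicator_of_mem hx]; exact hb x
      · rw [image_eq_zero_of_notMem_tsupport hx, norm_zero]; exact norm_nonneg _
    refine ⟨fun x => (f x : ℂ) * c, ?_, hcont, hmem, hcs⟩
    have i1 : eLpNorm ((fun x => (f x : ℂ) * c) - s.indicator fun _ => c) 2 μ ≤ δ := by
      refine (eLpNorm_mono fun x => ?_).trans (hη _ hV.le)
      rw [Pi.sub_apply]
      by_cases hx : x ∈ s
      · rw [Set.indicator_of_mem hx, f1 hx]; simp
      · rw [Set.indicator_of_notMem hx, sub_zero]
        by_cases hxV : x ∈ V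
        · rw [Set.indicator_of_mem (show x ∈ V \ s from ⟨hxV, hx⟩)]; exact hb x
        · rw [f0 hxV]; simp
    have i2 : eLpNorm ((s.indicator fun _ => c) - t.indicator fun _ => c) 2 μ ≤ δ := by
      rw [← eLpNorm_neg, neg_sub, ← Set.indicator_sdiff st]
      exact hη _ μs.le
    have m1 : AEStronglyMeasurable (s.indicator fun _ => c) μ :=
      aestronglyMeasurable_const.indicator hsc.measurableSet
    have m2 : AEStronglyMeasurable (t.indicator fun _ => c) μ :=
      aestronglyMeasurable_const.indicator ht
    have h := (hδ _ _ (hmem.aestronglyMeasurable.sub m1) (m1.sub m2) i1 i2).le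
    rwa [sub_add_sub_cancel] at h
  · rintro f g ⟨f1, f2, f3⟩ ⟨g1, g2, g3⟩
    exact ⟨f1.add g1, f2.add g2, f3.add g3⟩
  · rintro f ⟨-, hf, -⟩
    exact hf.aestronglyMeasurable

/-- The regular representation is strongly continuous. -/
theorem continuous_regularRep [LocallyCompactSpace G] [μ.Regular] (σ : ContTwoCocycle G)
    (x : Lp ℂ 2 μ) : Continuous fun s => regularRep σ μ s x := by
  -- The operators are isometric, so one approximation of `x` works uniformly in `s`.
  refine continuous_of_uniform_approx_of_continuous fun u hu => ?_
  obtain ⟨ε, hε, hεu⟩ := Metric.mem_uniformity_dist.1 hu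
  obtain ⟨g, hg2, hg3, hg4, hg1⟩ := exists_hasCompactSupport_eLpNorm_sub_le (Lp.memLp x)
    (ε := ENNReal.ofReal (ε / 2)) (by simpa using hε)
  refine ⟨_, continuous_regularRep_toLp σ hg3 hg1 hg4, fun s => hεu ?_⟩
  rw [dist_eq_norm, ← map_sub, norm_regularRep_apply, Lp.norm_def]
  have h : eLpNorm (⇑(x - hg4.toLp g)) 2 μ ≤ ENNReal.ofReal (ε / 2) := by
    refine le_trans (eLpNorm_congr_ae ?_).le hg2
    filter_upwards [Lp.coeFn_sub x (hg4.toLp g), hg4.coeFn_toLp] with t h1 h2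
    rw [h1, Pi.sub_apply, h2, Pi.sub_apply]
  refine (ENNReal.toReal_mono ENNReal.ofReal_ne_top h).trans_lt ?_
  rw [ENNReal.toReal_ofReal (by positivity)]
  linarith

end Rep

/-! ### Implementing operators and norm continuous factorizations -/

section Implementation

variable {G : Type u} [Group G] [TopologicalSpace G] [IsTopologicalGroup G]

theorem ContTwoCocycle.conj_mul_self (σ : ContTwoCocycle G) (s t : G) :
    conj (σ s t) * σ s t = 1 := by
  rw [Complex.conj_mul', σ.norm_eq_one']; simp

/-- The cocycle relation at `(sw, w⁻¹, w)`. It is what makes the correction factor `conj σ(w⁻¹,w)`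
in `V` the right one. -/
theorem ContTwoCocycle.mul_inv_identity (σ : ContTwoCocycle G) (s w : G) :
    conj (σ w⁻¹ w) * σ (s * w) w⁻¹ * σ s w = 1 := by
  have h := σ.cocycle' (s * w) w⁻¹ w
  rw [mul_inv_cancel_right, inv_mul_cancel, σ.right_one', one_mul] at h
  rw [mul_assoc, h, σ.conj_mul_self]

variable [MeasurableSpace G] [BorelSpace G] {μ : Measure G} [μ.IsHaarMeasure]

/-- A weakly continuous bounded factorization of `σ(t,s) φ(ts)` implements the map
`λ_{σ₂}(s) ↦ φ(s) λ_{σ₁}(s)` as `W* (· ⊗ 1) V`. -/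
theorem exists_implementing_ops [μ.Regular] {σ₁ σ₂ : ContTwoCocycle G} {φ : G → ℂ} {H : Type u}
    [NormedAddCommGroup H] [InnerProductSpace ℂ H] [CompleteSpace H] {ξ η : G → H} {a c : ℝ}
    (ha : 0 ≤ a) (hc : 0 ≤ c) (hξa : ∀ s, ‖ξ s‖ ≤ a) (hηc : ∀ t, ‖η t‖ ≤ c)
    (hξ : ∀ v, Continuous fun s => inner ℂ v (ξ s)) (hη : ∀ v, Continuous fun t => inner ℂ v (η t))
    (hk : ∀ s t, (star σ₁ * σ₂) t s * φ (t * s) = inner ℂ (η t) (ξ s)) :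
    ∃ (ι : Type u) (V W : Lp ℂ 2 μ →L[ℂ] lp (fun _ : ι => Lp ℂ 2 μ) 2),
      (∀ x, ‖V x‖ ≤ a * ‖x‖) ∧ (∀ x, ‖W x‖ ≤ c * ‖x‖) ∧
      ∀ s x y, inner ℂ (W y) (amplify ι (regularRep σ₂ μ s) (V x)) =
        φ s * inner ℂ y (regularRep σ₁ μ s x) := by
  obtain ⟨ι, b, -⟩ := exists_hilbertBasis ℂ H
  let σ := star σ₁ * σ₂
  -- With `t = sw`, the kernel at `(sw, w⁻¹)` is `σ(sw,w⁻¹) φ(s)`; the factor `conj σ(w⁻¹,w)`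
  -- reduces its phase to `conj σ(s,w)`, which changes `σ₂(s,w)` into `σ₁(s,w)`.
  let ξ' : G → H := fun w => conj (σ w⁻¹ w) • ξ w⁻¹
  have hξ' : ∀ v, Continuous fun w => inner ℂ v (ξ' w) := fun v => by
    simp only [ξ', inner_smul_right]
    exact ((σ.continuous'.comp (continuous_inv.prodMk continuous_id)).star).mul
      ((hξ v).comp continuous_inv)
  have hξ'a : ∀ w, ‖ξ' w‖ ≤ a := fun w => by
    simp only [ξ', norm_smul, RCLike.norm_conj, σ.norm_eq_one', one_mul]
    exact hξa _
  obtain ⟨V, hV, hV'⟩ := exists_weakColumnOp (μ := μ) b hξ' ha hξ'a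
  obtain ⟨W, hW, hW'⟩ := exists_weakColumnOp (μ := μ) b hη hc hηc
  refine ⟨ι, V, W, hV, hW, fun s x y => ?_⟩
  obtain ⟨I, hI, hI0⟩ := countable_coordinates_of_Lp b hη hηc y
  let h : ι → G → ℂ := fun i t => conj (inner ℂ (b i) (η t) * y t) *
    (σ₂ s (s⁻¹ * t) * (inner ℂ (b i) (ξ' (s⁻¹ * t)) * x (s⁻¹ * t)))
  have hh0 : ∀ i ∉ I, h i = 0 := fun i hi => by
    ext t; simp only [h, hI0 i hi t, map_zero, zero_mul, Pi.zero_apply]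
  have hae : ∀ i, (fun t => inner ℂ (W y i t) (regularRep σ₂ μ s (V x i) t)) =ᵐ[μ] h i := by
    intro i
    filter_upwards [hW' y i, regularRep_apply σ₂ μ s (V x i),
      (measurePreserving_mul_left μ s⁻¹).quasiMeasurePreserving.ae_eq_comp (hV' x i)]
      with t h1 h2 h3
    simp only [Function.comp_apply] at h3
    rw [h1, h2, h3, RCLike.inner_apply, mul_comm]
  have hint : ∀ i, Integrable (h i) μ := fun i =>
    (L2.integrable_inner (𝕜 := ℂ) (W y i) (regularRep σ₂ μ s (V x i))).congr (hae i)
  have hval : ∀ i, inner ℂ (W y i) (regularRep σ₂ μ s (V x i)) = ∫ t, h i t ∂μ := fun i => by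
    rw [L2.inner_def]; exact integral_congr_ae (hae i)
  have hnorm : ∀ i, ∫ t, ‖h i t‖ ∂μ ≤ ‖W y i‖ ^ 2 + ‖V x i‖ ^ 2 := fun i => by
    rw [← norm_regularRep_apply σ₂ μ s (V x i), norm_sq_eq_integral, norm_sq_eq_integral,
      ← integral_add (integrable_norm_sq _) (integrable_norm_sq _)]
    refine integral_mono_ae (hint i).norm
      ((integrable_norm_sq _).add (integrable_norm_sq _)) ?_
    filter_upwards [hae i] with t ht
    rw [← ht]
    refine (norm_inner_le_norm _ _).trans ?_
    nlinarith [sq_nonneg (‖(W y i : Lp ℂ 2 μ) t‖ - ‖(regularRep σ₂ μ s (V x i) : Lp ℂ 2 μ) t‖),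
      sq_nonneg ‖(W y i : Lp ℂ 2 μ) t‖, sq_nonneg ‖(regularRep σ₂ μ s (V x i) : Lp ℂ 2 μ) t‖]
  have hsum : Summable fun i => ∫ t, ‖h i t‖ ∂μ :=
    Summable.of_nonneg_of_le (fun i => integral_nonneg fun t => norm_nonneg _) hnorm
      ((hasSum_norm_sq (W y)).summable.add (hasSum_norm_sq (V x)).summable)
  have h1 : HasSum (fun i => ∫ t, h i t ∂μ)
      (inner ℂ (W y) (amplify ι (regularRep σ₂ μ s) (V x))) := by
    simpa only [hval] using hasSum_inner_amplify (regularRep σ₂ μ s) (V x) (W y)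
  have h2 : HasSum (fun i : I => ∫ t, h i t ∂μ)
      (inner ℂ (W y) (amplify ι (regularRep σ₂ μ s) (V x))) := by
    refine (hasSum_subtype_iff_of_support_subset (s := I) fun i hi => ?_).2 h1
    by_contra hiI
    simp [hh0 i hiI] at hi
  have := hI.to_subtype
  have h3 := hasSum_integral_of_summable_integral_norm (μ := μ) (F := fun (i : I) t => h i t)
    (fun i => hint i) (hsum.subtype I)
  rw [h2.unique h3, L2.inner_def, ← integral_const_mul]
  refine integral_congr_ae ?_
  filter_upwards [regularRep_apply σ₁ μ s x] with t ht
  have h4 : ∑' i : I, h i t = ∑' i, h i t := by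
    refine tsum_subtype_eq_of_support_subset (f := fun i => h i t) fun i hi => ?_
    by_contra hiI
    simp [hh0 i hiI] at hi
  have h5 : ∑' i, h i t = inner ℂ (η t) (ξ' (s⁻¹ * t)) *
      (conj (y t) * σ₂ s (s⁻¹ * t) * x (s⁻¹ * t)) := by
    rw [← b.tsum_inner_mul_inner, ← tsum_mul_right]
    refine tsum_congr fun i => ?_
    simp only [h, map_mul, inner_conj_symm]
    ring
  obtain ⟨w, rfl⟩ : ∃ w, t = s * w := ⟨s⁻¹ * t, (mul_inv_cancel_left _ _).symm⟩
  rw [h4, h5, ht, RCLike.inner_apply, inv_mul_cancel_left]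
  simp only [ξ', inner_smul_right]
  rw [← hk, mul_inv_cancel_right]
  show conj (σ w⁻¹ w) * (σ (s * w) w⁻¹ * φ s) * _ = _
  have h6 := σ.mul_inv_identity s w
  have h7 : σ s w = conj (σ₁ s w) * σ₂ s w := rfl
  have h8 := σ₁.conj_mul_self s w
  rw [h7] at h6
  linear_combination (φ s * conj (y (s * w)) * x w * σ₁ s w) * h6 -
    (φ s * conj (y (s * w)) * x w * σ₂ s w * conj (σ w⁻¹ w) * σ (s * w) w⁻¹) * h8

theorem regularRep_mul_star (σ : ContTwoCocycle G) (s : G) :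
    regularRep σ μ s * star (regularRep σ μ s) = 1 := by
  have h : σ s s⁻¹ = σ s⁻¹ s := by
    have := σ.cocycle' s s⁻¹ s
    rwa [mul_inv_cancel, inv_mul_cancel, σ.left_one', σ.right_one', mul_one, one_mul] at this
  rw [star_regularRep, mul_smul_comm, regularRep_mul, mul_inv_cancel, regularRep_one, smul_smul, h,
    Complex.star_def, σ.conj_mul_self, one_smul]

theorem norm_star_regularRep_apply (σ : ContTwoCocycle G) (s : G) (x : Lp ℂ 2 μ) :
    ‖star (regularRep σ μ s) x‖ = ‖x‖ := by
  rw [star_regularRep, smul_apply, norm_smul, norm_star, σ.norm_eq_one', one_mul,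
    norm_regularRep_apply]

theorem continuous_star_regularRep [LocallyCompactSpace G] [μ.Regular] (σ : ContTwoCocycle G)
    (x : Lp ℂ 2 μ) : Continuous fun s => star (regularRep σ μ s) x := by
  simp only [star_regularRep, smul_apply]
  exact ((σ.continuous'.comp (continuous_inv.prodMk continuous_id)).star).smul
    ((continuous_regularRep σ x).comp continuous_inv)

/-- From `λ_{σ₁}(ts) λ_{σ₁}(s)* = conj σ₁(t,s) λ_{σ₁}(t)`. It recovers the kernel from matrix
coefficients of `φ(ts) λ_{σ₁}(ts)`, and serves both the Schur bound and the continuous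
factorization. -/
theorem inner_regularRep_twist (σ₁ σ₂ : ContTwoCocycle G) (φ : G → ℂ) {x : Lp ℂ 2 μ} (hx : ‖x‖ = 1)
    (s t : G) : σ₂ t s * (φ (t * s) * inner ℂ (regularRep σ₁ μ t x)
      (regularRep σ₁ μ (t * s) (star (regularRep σ₁ μ s) x))) =
      (star σ₁ * σ₂) t s * φ (t * s) := by
  have h1 : regularRep σ₁ μ (t * s) (star (regularRep σ₁ μ s) x) =
      conj (σ₁ t s) • regularRep σ₁ μ t x := by
    have h := congrArg (fun T : Lp ℂ 2 μ →L[ℂ] Lp ℂ 2 μ =>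
      conj (σ₁ t s) • T (star (regularRep σ₁ μ s) x)) (regularRep_mul σ₁ μ t s)
    simp only [smul_apply, smul_smul, σ₁.conj_mul_self, one_smul] at h
    rw [← h]
    have h2 := congrArg (fun T : Lp ℂ 2 μ →L[ℂ] Lp ℂ 2 μ => T x) (regularRep_mul_star (μ := μ) σ₁ s)
    exact congrArg (fun v => conj (σ₁ t s) • regularRep σ₁ μ t v) h2
  rw [h1, inner_smul_right, inner_self_eq_norm_sq_to_K, norm_regularRep_apply, hx,
    ContTwoCocycle.mul_apply, ContTwoCocycle.star_apply, Complex.star_def]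
  simp only [map_one, one_pow]
  ring

/-- A weakly continuous bounded factorization can be replaced by a continuous one. -/
theorem exists_continuous_gram [LocallyCompactSpace G] [T2Space G] [μ.Regular]
    {σ₁ σ₂ : ContTwoCocycle G} {φ : G → ℂ} {ι : Type u} {a c : ℝ}
    {V W : Lp ℂ 2 μ →L[ℂ] lp (fun _ : ι => Lp ℂ 2 μ) 2}
    (hV : ∀ x, ‖V x‖ ≤ a * ‖x‖) (hW : ∀ x, ‖W x‖ ≤ c * ‖x‖)
    (h : ∀ s x y, inner ℂ (W y) (amplify ι (regularRep σ₂ μ s) (V x)) =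
        φ s * inner ℂ y (regularRep σ₁ μ s x)) :
    ∃ ξ η : G → lp (fun _ : ι => Lp ℂ 2 μ) 2, Continuous ξ ∧ Continuous η ∧
      (∀ s, ‖ξ s‖ ≤ a) ∧ (∀ t, ‖η t‖ ≤ c) ∧
      ∀ s t, (star σ₁ * σ₂) t s * φ (t * s) = inner ℂ (η t) (ξ s) := by
  obtain ⟨x₀, hx₀⟩ := exists_norm_one (μ := μ)
  have u₁ : ∀ s v, ‖amplify ι (regularRep σ₂ μ s) v‖ = ‖v‖ := fun s =>
    norm_amplify_of_isometry (norm_regularRep_apply σ₂ μ s)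
  have u₂ : ∀ s v, ‖amplify ι (star (regularRep σ₂ μ s)) v‖ = ‖v‖ := fun s =>
    norm_amplify_of_isometry (norm_star_regularRep_apply σ₂ s)
  have c₁ : ∀ v, Continuous fun s => amplify ι (regularRep σ₂ μ s) v :=
    continuous_amplify (norm_regularRep_apply σ₂ μ) (continuous_regularRep σ₂)
  have c₂ : ∀ v, Continuous fun s => amplify ι (star (regularRep σ₂ μ s)) v :=
    continuous_amplify (norm_star_regularRep_apply σ₂) (continuous_star_regularRep σ₂)
  refine ⟨fun s => amplify ι (regularRep σ₂ μ s) (V (star (regularRep σ₁ μ s) x₀)),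
    fun t => amplify ι (star (regularRep σ₂ μ t)) (W (regularRep σ₁ μ t x₀)), ?_, ?_, fun s => ?_,
    fun t => ?_, fun s t => ?_⟩
  · exact continuous_isometry_apply (U := fun s => amplify ι (regularRep σ₂ μ s)) u₁ c₁
      (V.continuous.comp (continuous_star_regularRep σ₁ x₀))
  · exact continuous_isometry_apply (U := fun t => amplify ι (star (regularRep σ₂ μ t))) u₂ c₂
      (W.continuous.comp (continuous_regularRep σ₁ x₀))
  · rw [u₁]
    simpa only [norm_star_regularRep_apply, hx₀, mul_one] using hV (star (regularRep σ₁ μ s) x₀)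
  · rw [u₂]
    simpa only [norm_regularRep_apply, hx₀, mul_one] using hW (regularRep σ₁ μ t x₀)
  · rw [inner_amplify_star, ← amplify_mul, regularRep_mul, amplify_smul, inner_smul_right, h,
      inner_regularRep_twist σ₁ σ₂ φ hx₀]

/-- The elements of `A(G, σ)` are continuous functions. -/
theorem continuous_toFun [LocallyCompactSpace G] [μ.Regular] (σ : ContTwoCocycle G)
    (ψ : FourierSpace σ μ) : Continuous (FourierSpace.toFun σ μ ψ) := by
  obtain ⟨x, y, hxy, h⟩ := exists_hasSum_pairing ψ
  have h1 : FourierSpace.toFun σ μ ψ = fun s => ∑' n, inner ℂ (y n) (regularRep σ μ s (x n)) :=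
    funext fun s => (h (regularRepVN σ μ s)).tsum_eq.symm
  rw [h1]
  refine continuous_tsum (fun n => continuous_const.inner (continuous_regularRep σ (x n))) hxy
    fun n s => (norm_inner_le_norm _ _).trans ?_
  rw [norm_regularRep_apply, mul_comm]

/-- Multipliers are continuous. -/
theorem IsMultiplier.continuous [LocallyCompactSpace G] [T2Space G] [μ.Regular]
    {σ₁ σ₂ : ContTwoCocycle G} {φ : G → ℂ} (h : IsMultiplier σ₁ σ₂ μ φ) : Continuous φ := by
  refine continuous_iff_continuousAt.2 fun s₀ => ?_
  obtain ⟨x₀, hx₀⟩ := exists_norm_one (μ := μ)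
  -- A coefficient function with `ψ(s₀) = ‖x₀‖² = 1`; near `s₀`, `φ` is the quotient of the
  -- continuous functions `φψ` and `ψ`.
  obtain ⟨ψ, hψ⟩ := exists_predual_vector (twistedVN σ₁ μ) x₀ (regularRep σ₁ μ s₀ x₀)
  have h1 : FourierSpace.toFun σ₁ μ ψ s₀ ≠ 0 := by
    show Predual.pairing _ ψ (regularRepVN σ₁ μ s₀) ≠ 0
    rw [hψ]
    refine inner_self_ne_zero.2 (norm_ne_zero_iff.1 ?_)
    rw [norm_regularRep_apply, hx₀]
    exact one_ne_zero
  have h2 := continuous_toFun σ₁ ψ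
  have h3 := continuous_toFun σ₂ (h.map ψ)
  refine (h3.continuousAt.div h2.continuousAt h1).congr ?_
  filter_upwards [h2.continuousAt.eventually_ne h1] with s hs
  rw [Pi.div_apply, h.toFun_map, mul_div_cancel_right₀ _ hs]

end Implementation

/-! ### The maps `T ↦ W* (T ⊗ 1) V` -/

section Sandwich

theorem norm_apply_le_of_inner {E F : Type*} [NormedAddCommGroup E] [InnerProductSpace ℂ E]
    [NormedAddCommGroup F] [InnerProductSpace ℂ F] (A : E →L[ℂ] F) {C : ℝ} {x : E}
    (h : ∀ y, ‖inner ℂ y (A x)‖ ≤ C * ‖x‖ * ‖y‖) (hC : 0 ≤ C) : ‖A x‖ ≤ C * ‖x‖ := by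
  have h1 := h (A x)
  rw [inner_self_eq_norm_sq_to_K, norm_pow, RCLike.norm_ofReal, abs_norm, sq] at h1
  by_cases h0 : ‖A x‖ = 0
  · rw [h0]; positivity
  · exact le_of_mul_le_mul_right h1 (lt_of_le_of_ne (norm_nonneg _) (Ne.symm h0))

variable {ι H : Type*} [NormedAddCommGroup H] [InnerProductSpace ℂ H] [CompleteSpace H]

theorem norm_amplify_le (T : H →L[ℂ] H) (x : lp (fun _ : ι => H) 2) :
    ‖amplify ι T x‖ ≤ ‖T‖ * ‖x‖ :=
  (exists_amplify ι T).choose_spec.1 x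

/-- The map `T ↦ W* (T ⊗ 1) V`. -/
noncomputable def sandwich (V W : H →L[ℂ] lp (fun _ : ι => H) 2) (T : H →L[ℂ] H) : H →L[ℂ] H :=
  ContinuousLinearMap.adjoint W ∘L amplify ι T ∘L V

theorem inner_sandwich (V W : H →L[ℂ] lp (fun _ : ι => H) 2) (T : H →L[ℂ] H) (x y : H) :
    inner ℂ y (sandwich V W T x) = inner ℂ (W y) (amplify ι T (V x)) :=
  ContinuousLinearMap.adjoint_inner_right W y (amplify ι T (V x))

theorem norm_sq_eq_sum {k : ℕ} (x : PiLp 2 (fun _ : Fin k => H)) :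
    ‖x‖ ^ 2 = ∑ q, ‖x q‖ ^ 2 := PiLp.norm_sq_eq_of_L2 _ x

theorem inner_matrixOp {k : ℕ} (S : Matrix (Fin k) (Fin k) (H →L[ℂ] H))
    (x y : PiLp 2 (fun _ : Fin k => H)) :
    inner ℂ y (matrixOp S x) = ∑ p, ∑ q, inner ℂ (y p) (S p q (x q)) := by
  rw [PiLp.inner_apply]
  simp only [matrixOp_apply, inner_sum]

/-- The vector in `ℓ²(ι, H^k)` with components `V x_q`. -/
theorem exists_transpose {k : ℕ} {V : H →L[ℂ] lp (fun _ : ι => H) 2} {a : ℝ} (ha : 0 ≤ a)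
    (hV : ∀ x, ‖V x‖ ≤ a * ‖x‖) (x : PiLp 2 (fun _ : Fin k => H)) :
    ∃ X : lp (fun _ : ι => PiLp 2 (fun _ : Fin k => H)) 2, ‖X‖ ≤ a * ‖x‖ ∧
      ∀ i q, X i q = V (x q) i := by
  have h1 : HasSum (fun i => ‖(WithLp.toLp 2 fun q => V (x q) i :
      PiLp 2 (fun _ : Fin k => H))‖ ^ 2) (∑ q, ‖V (x q)‖ ^ 2) := by
    simp only [norm_sq_eq_sum]
    exact hasSum_sum fun q _ => hasSum_norm_sq (V (x q))
  let X : lp (fun _ : ι => PiLp 2 (fun _ : Fin k => H)) 2 :=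
    ⟨fun i => WithLp.toLp 2 fun q => V (x q) i, memℓp_two h1.summable⟩
  refine ⟨X, ?_, fun i q => rfl⟩
  refine (sq_le_sq₀ (norm_nonneg _) (by positivity)).1 ?_
  rw [(hasSum_norm_sq X).unique h1, mul_pow, norm_sq_eq_sum x, Finset.mul_sum]
  refine Finset.sum_le_sum fun q _ => ?_
  rw [← mul_pow]
  exact pow_le_pow_left₀ (norm_nonneg _) (hV _) 2

/-- Transposing `ℓ²(ι, H)^k` into `ℓ²(ι, H^k)` writes the matrix of sandwiches as one sandwich of
the amplified operator `matrixOp S`, with the same bounds `a` and `c` whatever `k` is. -/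
theorem norm_matrixOp_sandwich_le {k : ℕ} {V W : H →L[ℂ] lp (fun _ : ι => H) 2} {a c : ℝ}
    (ha : 0 ≤ a) (hc : 0 ≤ c) (hV : ∀ x, ‖V x‖ ≤ a * ‖x‖) (hW : ∀ x, ‖W x‖ ≤ c * ‖x‖)
    (S : Matrix (Fin k) (Fin k) (H →L[ℂ] H)) :
    ‖matrixOp (S.map (sandwich V W))‖ ≤ a * c * ‖matrixOp S‖ := by
  refine ContinuousLinearMap.opNorm_le_bound _ (by positivity) fun x =>
    norm_apply_le_of_inner _ (fun y => ?_) (by positivity)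
  obtain ⟨X, hX, hX'⟩ := exists_transpose ha hV x
  obtain ⟨Y, hY, hY'⟩ := exists_transpose hc hW y
  have h1 : HasSum (fun i => inner ℂ (Y i) (matrixOp S (X i)))
      (inner ℂ y (matrixOp (S.map (sandwich V W)) x)) := by
    simp only [inner_matrixOp, Matrix.map_apply, inner_sandwich, hX', hY']
    exact hasSum_sum fun p _ => hasSum_sum fun q _ => hasSum_inner_amplify _ _ _
  rw [h1.unique (hasSum_inner_amplify _ X Y)]
  calc ‖inner ℂ Y (amplify ι (matrixOp S) X)‖ ≤ ‖Y‖ * (‖matrixOp S‖ * ‖X‖) :=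
        (norm_inner_le_norm _ _).trans
          (mul_le_mul_of_nonneg_left (norm_amplify_le _ _) (norm_nonneg _))
    _ ≤ (c * ‖y‖) * (‖matrixOp S‖ * (a * ‖x‖)) := by gcongr
    _ = a * c * ‖matrixOp S‖ * ‖x‖ * ‖y‖ := by ring

theorem summable_norm_mul_norm (x y : lp (fun _ : ι => H) 2) :
    (Summable fun i => ‖x i‖ * ‖y i‖) ∧ ∑' i, ‖x i‖ * ‖y i‖ ≤ ‖x‖ * ‖y‖ :=
  lp.tsum_mul_le_mul_norm (by simpa using Real.HolderConjugate.two_two) x y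

theorem exists_predual_amplify (M : VonNeumannAlgebra H) (x y : lp (fun _ : ι => H) 2) :
    ∃ ψ : Predual M, ∀ T : M.toStarSubalgebra,
      Predual.pairing M ψ T = inner ℂ y (amplify ι (T : H →L[ℂ] H) x) := by
  obtain ⟨ψ, h⟩ := exists_predual M (fun i => x i) (fun i => y i) (summable_norm_mul_norm x y).1
  exact ⟨ψ, fun T => (h T).unique (hasSum_inner_amplify _ _ _)⟩

/-- The maps `T ↦ W* (T ⊗ 1) V` are normal. -/
theorem exists_predual_comp_sandwich {M N : VonNeumannAlgebra H}
    {V W : H →L[ℂ] lp (fun _ : ι => H) 2} {a c : ℝ} (ha : 0 ≤ a)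
    (hV : ∀ x, ‖V x‖ ≤ a * ‖x‖) (hW : ∀ x, ‖W x‖ ≤ c * ‖x‖)
    (hΦ : ∀ T : N.toStarSubalgebra, sandwich V W T ∈ M.toStarSubalgebra) (ψ : Predual M) :
    ∃ θ : Predual N, ∀ T : N.toStarSubalgebra,
      Predual.pairing N θ T = Predual.pairing M ψ ⟨sandwich V W T, hΦ T⟩ := by
  obtain ⟨x, y, hxy, hψ⟩ := exists_hasSum_pairing ψ
  -- Composing `∑ₙ ω_{xₙ,yₙ}` with the sandwich gives a double series of vector functionals with
  -- vectors `(V xₙ)_i` and `(W yₙ)_i`. Cauchy-Schwarz in `i` bounds its `n`th part by `ac ‖xₙ‖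
  -- ‖yₙ‖`.
  have hs : Summable fun j : ℕ × ι => ‖V (x j.1) j.2‖ * ‖W (y j.1) j.2‖ := by
    refine (summable_prod_of_nonneg fun j => mul_nonneg (norm_nonneg _) (norm_nonneg _)).2
      ⟨fun n => (summable_norm_mul_norm (V (x n)) (W (y n))).1, ?_⟩
    refine Summable.of_nonneg_of_le
      (fun n => tsum_nonneg fun i => mul_nonneg (norm_nonneg _) (norm_nonneg _))
      (fun n => (summable_norm_mul_norm (V (x n)) (W (y n))).2.trans
        (mul_le_mul (hV _) (hW _) (norm_nonneg _) (by positivity))) ?_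
    refine (hxy.mul_left (a * c)).congr fun n => by ring
  obtain ⟨θ, hθ⟩ := exists_predual N (fun j : ℕ × ι => V (x j.1) j.2) (fun j => W (y j.1) j.2) hs
  refine ⟨θ, fun T => ?_⟩
  have h1 := (hθ T).prod_fiberwise fun n =>
    hasSum_inner_amplify (T : H →L[ℂ] H) (V (x n)) (W (y n))
  simp only [← inner_sandwich] at h1
  exact h1.unique (hψ ⟨sandwich V W T, hΦ T⟩)

theorem norm_toEuclideanCLM_pairing_le {M : VonNeumannAlgebra H} {n k : ℕ}
    {ψ : Matrix (Fin n) (Fin n) (Predual M)} {r : ℝ≥0∞} (hψ : predualMatrixNorm ψ ≤ r)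
    (T : Matrix (Fin k) (Fin k) M.toStarSubalgebra)
    (hT : ‖matrixOp (T.map fun x => (x : H →L[ℂ] H))‖ ≤ 1) :
    ‖Matrix.toEuclideanCLM (𝕜 := ℂ) (Matrix.of fun a b : Fin k × Fin n =>
      Predual.pairing M (ψ a.2 b.2) (T a.1 b.1))‖ₑ ≤ r := by
  refine le_trans ?_ hψ
  unfold predualMatrixNorm
  exact le_iSup₂_of_le k T (le_iSup_of_le hT le_rfl)

/-- The preadjoint of `T ↦ W* (T ⊗ 1) V` is completely bounded. -/
theorem cbNorm_le_of_sandwich {M N : VonNeumannAlgebra H}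
    {V W : H →L[ℂ] lp (fun _ : ι => H) 2} {a c r : ℝ} (ha : 0 ≤ a) (hc : 0 ≤ c)
    (hV : ∀ x, ‖V x‖ ≤ a * ‖x‖) (hW : ∀ x, ‖W x‖ ≤ c * ‖x‖)
    (hΦ : ∀ T : N.toStarSubalgebra, sandwich V W T ∈ M.toStarSubalgebra)
    (m : Predual M →ₗ[ℂ] Predual N) (hm : ∀ ψ (T : N.toStarSubalgebra),
      Predual.pairing N (m ψ) T = Predual.pairing M ψ ⟨sandwich V W T, hΦ T⟩)
    (hr : 0 < r) (hacr : a * c ≤ r) : cbNorm m ≤ ENNReal.ofReal r := by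
  refine iSup_le fun n => iSup_le fun ψ => iSup_le fun hψ => iSup_le fun k => iSup_le fun T =>
    iSup_le fun hT => ?_
  let Φ : N.toStarSubalgebra → M.toStarSubalgebra := fun T => ⟨sandwich V W T, hΦ T⟩
  -- Dividing by `r` puts the image matrix in the unit ball, where the bound on `ψ` applies; hence
  -- the requirement `0 < r`.
  let T' : Matrix (Fin k) (Fin k) M.toStarSubalgebra := Matrix.of fun p q => (r : ℂ)⁻¹ • Φ (T p q)
  have hr' : (r : ℂ) ≠ 0 := by exact_mod_cast hr.ne'
  have h1 : matrixOp (T'.map fun x => (x : H →L[ℂ] H)) = (r : ℂ)⁻¹ •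
      matrixOp ((T.map fun x => (x : H →L[ℂ] H)).map (sandwich V W)) := by
    ext x p
    simp only [smul_apply, PiLp.smul_apply, matrixOp_apply, Finset.smul_sum]
    rfl
  have h2 : ‖matrixOp (T'.map fun x => (x : H →L[ℂ] H))‖ ≤ 1 := by
    rw [h1, norm_smul, norm_inv, Complex.norm_real, Real.norm_of_nonneg hr.le, inv_mul_le_one₀ hr]
    refine (norm_matrixOp_sandwich_le ha hc hV hW _).trans ?_
    calc a * c * _ ≤ a * c * 1 := by gcongr
      _ ≤ r := by rwa [mul_one]
  have h3 := norm_toEuclideanCLM_pairing_le hψ T' h2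
  have h4 : (Matrix.of fun a b : Fin k × Fin n =>
      Predual.pairing N (ψ.map m a.2 b.2) (T a.1 b.1)) = (r : ℂ) • (Matrix.of
        fun a b : Fin k × Fin n => Predual.pairing M (ψ a.2 b.2) (T' a.1 b.1)) := by
    ext a b
    simp only [Matrix.of_apply, Matrix.map_apply, hm, Matrix.smul_apply, T', map_smul, smul_smul,
      mul_inv_cancel₀ hr', one_smul, Φ]
  rw [h4, map_smul, enorm_smul]
  have h5 : ‖(r : ℂ)‖ₑ = ENNReal.ofReal r := by
    rw [← ofReal_norm, Complex.norm_real, Real.norm_of_nonneg hr.le]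
  rw [h5]
  exact mul_le_of_le_one_right' h3

end Sandwich

/-! ### From implementing operators to completely bounded multipliers -/

section Sufficiency

variable {G : Type u} [Group G] [TopologicalSpace G] [IsTopologicalGroup G]
  [MeasurableSpace G] [BorelSpace G] {μ : Measure G} [μ.IsHaarMeasure]

theorem coe_regularRepVN (σ : ContTwoCocycle G) (s : G) :
    (regularRepVN σ μ s : Lp ℂ 2 μ →L[ℂ] Lp ℂ 2 μ) = regularRep σ μ s := rfl

theorem fourierSpace_ext {σ : ContTwoCocycle G} {ψ₁ ψ₂ : FourierSpace σ μ}
    (h : ∀ s, Predual.pairing _ ψ₁ (regularRepVN σ μ s) =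
      Predual.pairing _ ψ₂ (regularRepVN σ μ s)) : ψ₁ = ψ₂ :=
  FourierSpace.toFun_injective σ μ (funext h)

theorem mem_twistedVN_of_commute (σ : ContTwoCocycle G) {B : Lp ℂ 2 μ →L[ℂ] Lp ℂ 2 μ}
    (hB : ∀ A : Lp ℂ 2 μ →L[ℂ] Lp ℂ 2 μ,
      (∀ s x, regularRep σ μ s (A x) = A (regularRep σ μ s x)) → ∀ x, A (B x) = B (A x)) :
    B ∈ (twistedVN σ μ).toStarSubalgebra := by
  rw [← SetLike.mem_coe, twistedVN, coe_generatedVN]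
  intro A hA
  refine ContinuousLinearMap.ext (hB A fun s x => ?_)
  exact congrArg (fun B : Lp ℂ 2 μ →L[ℂ] Lp ℂ 2 μ => B x)
    (hA (regularRep σ μ s) (Or.inl ⟨s, rfl⟩))

/-- Normal functionals `⟨(· ⊗ 1) x, y⟩` on `VN(G, σ)` are determined by their values at the
`λ_σ(s)`. -/
theorem inner_amplify_eq {σ : ContTwoCocycle G} {ι : Type u}
    {x₁ y₁ x₂ y₂ : lp (fun _ : ι => Lp ℂ 2 μ) 2}
    (h : ∀ s, inner ℂ y₁ (amplify ι (regularRep σ μ s) x₁) =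
      inner ℂ y₂ (amplify ι (regularRep σ μ s) x₂)) (T : (twistedVN σ μ).toStarSubalgebra) :
    inner ℂ y₁ (amplify ι (T : Lp ℂ 2 μ →L[ℂ] Lp ℂ 2 μ) x₁) =
      inner ℂ y₂ (amplify ι (T : Lp ℂ 2 μ →L[ℂ] Lp ℂ 2 μ) x₂) := by
  obtain ⟨ψ₁, h₁⟩ := exists_predual_amplify (twistedVN σ μ) x₁ y₁
  obtain ⟨ψ₂, h₂⟩ := exists_predual_amplify (twistedVN σ μ) x₂ y₂
  have heq : ψ₁ = ψ₂ := fourierSpace_ext fun s => by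
    rw [h₁, h₂, coe_regularRepVN, h]
  rw [← h₁, ← h₂, heq]

/-- If `A` commutes with every `λ_{σ₁}(s)`, then `T ↦ ⟨A Φ(T) x, y⟩` and `T ↦ ⟨Φ(T) A x, y⟩` are
normal and agree at each `λ_{σ₂}(s)`, hence everywhere. So `Φ(T)` lies in the bicommutant. -/
theorem sandwich_mem_twistedVN {σ₁ σ₂ : ContTwoCocycle G} {φ : G → ℂ} {ι : Type u}
    {V W : Lp ℂ 2 μ →L[ℂ] lp (fun _ : ι => Lp ℂ 2 μ) 2}
    (h : ∀ s x y, inner ℂ (W y) (amplify ι (regularRep σ₂ μ s) (V x)) =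
        φ s * inner ℂ y (regularRep σ₁ μ s x)) (T : (twistedVN σ₂ μ).toStarSubalgebra) :
    sandwich V W T ∈ (twistedVN σ₁ μ).toStarSubalgebra := by
  refine mem_twistedVN_of_commute σ₁ fun A hA x => ext_inner_left ℂ fun y => ?_
  rw [← ContinuousLinearMap.adjoint_inner_left, inner_sandwich, inner_sandwich]
  refine inner_amplify_eq (fun s => ?_) T
  have e := ContinuousLinearMap.adjoint_inner_left A (regularRep σ₁ μ s x) y
  rw [← hA] at e
  exact (h s x _).trans ((congrArg (φ s * ·) e).trans (h s (A x) y).symm)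

theorem sandwich_regularRep {σ₁ σ₂ : ContTwoCocycle G} {φ : G → ℂ} {ι : Type u}
    {V W : Lp ℂ 2 μ →L[ℂ] lp (fun _ : ι => Lp ℂ 2 μ) 2}
    (h : ∀ s x y, inner ℂ (W y) (amplify ι (regularRep σ₂ μ s) (V x)) =
        φ s * inner ℂ y (regularRep σ₁ μ s x)) (s : G) :
    sandwich V W (regularRep σ₂ μ s) = φ s • regularRep σ₁ μ s := by
  refine ContinuousLinearMap.ext fun x => ext_inner_left ℂ fun y => ?_
  rw [inner_sandwich, h, smul_apply, inner_smul_right]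

theorem toFun_eq_of_pairing_sandwich {σ₁ σ₂ : ContTwoCocycle G} {φ : G → ℂ} {ι : Type u}
    {V W : Lp ℂ 2 μ →L[ℂ] lp (fun _ : ι => Lp ℂ 2 μ) 2}
    (h : ∀ s x y, inner ℂ (W y) (amplify ι (regularRep σ₂ μ s) (V x)) =
        φ s * inner ℂ y (regularRep σ₁ μ s x))
    (ψ : FourierSpace σ₁ μ) (θ : FourierSpace σ₂ μ)
    (hθ : ∀ T : (twistedVN σ₂ μ).toStarSubalgebra, Predual.pairing _ θ T =
      Predual.pairing _ ψ ⟨sandwich V W T, sandwich_mem_twistedVN h T⟩) (s : G) :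
    FourierSpace.toFun σ₂ μ θ s = φ s * FourierSpace.toFun σ₁ μ ψ s := by
  refine (hθ (regularRepVN σ₂ μ s)).trans ?_
  have h1 : (⟨sandwich V W (regularRepVN σ₂ μ s : Lp ℂ 2 μ →L[ℂ] Lp ℂ 2 μ),
      sandwich_mem_twistedVN h (regularRepVN σ₂ μ s)⟩ : (twistedVN σ₁ μ).toStarSubalgebra) =
      φ s • regularRepVN σ₁ μ s := Subtype.ext (sandwich_regularRep h s)
  rw [h1]
  exact map_smul (Predual.pairing _ ψ) (φ s) (regularRepVN σ₁ μ s)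

theorem isMultiplier_of_implementing {σ₁ σ₂ : ContTwoCocycle G} {φ : G → ℂ} {ι : Type u} {a c : ℝ}
    (ha : 0 ≤ a) {V W : Lp ℂ 2 μ →L[ℂ] lp (fun _ : ι => Lp ℂ 2 μ) 2}
    (hV : ∀ x, ‖V x‖ ≤ a * ‖x‖) (hW : ∀ x, ‖W x‖ ≤ c * ‖x‖)
    (h : ∀ s x y, inner ℂ (W y) (amplify ι (regularRep σ₂ μ s) (V x)) =
        φ s * inner ℂ y (regularRep σ₁ μ s x)) : IsMultiplier σ₁ σ₂ μ φ := fun ψ => by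
  obtain ⟨θ, h1⟩ := exists_predual_comp_sandwich ha hV hW (sandwich_mem_twistedVN h) ψ
  exact ⟨θ, toFun_eq_of_pairing_sandwich h ψ θ h1⟩

theorem IsMultiplier.map_eq_of_toFun {σ₁ σ₂ : ContTwoCocycle G} {φ : G → ℂ}
    (hφ : IsMultiplier σ₁ σ₂ μ φ) {ψ : FourierSpace σ₁ μ} {θ : FourierSpace σ₂ μ}
    (h : ∀ s, FourierSpace.toFun σ₂ μ θ s = φ s * FourierSpace.toFun σ₁ μ ψ s) :
    hφ.map ψ = θ :=
  FourierSpace.toFun_injective σ₂ μ <| funext fun s => (hφ.toFun_map ψ s).trans (h s).symm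

set_option maxHeartbeats 800000 in
theorem pairing_map_eq_sandwich {σ₁ σ₂ : ContTwoCocycle G} {φ : G → ℂ} {ι : Type u} {a c : ℝ}
    (ha : 0 ≤ a) {V W : Lp ℂ 2 μ →L[ℂ] lp (fun _ : ι => Lp ℂ 2 μ) 2}
    (hV : ∀ x, ‖V x‖ ≤ a * ‖x‖) (hW : ∀ x, ‖W x‖ ≤ c * ‖x‖)
    (h : ∀ s x y, inner ℂ (W y) (amplify ι (regularRep σ₂ μ s) (V x)) =
        φ s * inner ℂ y (regularRep σ₁ μ s x)) (hφ : IsMultiplier σ₁ σ₂ μ φ)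
    (ψ : FourierSpace σ₁ μ) (T : (twistedVN σ₂ μ).toStarSubalgebra) :
    Predual.pairing _ (hφ.map ψ) T =
      Predual.pairing _ ψ ⟨sandwich V W T, sandwich_mem_twistedVN h T⟩ := by
  obtain ⟨θ, h1⟩ := exists_predual_comp_sandwich ha hV hW (sandwich_mem_twistedVN h) ψ
  rw [hφ.map_eq_of_toFun (toFun_eq_of_pairing_sandwich h ψ θ h1)]
  exact h1 T

/-- A factorization of `σ(t,s) φ(ts)` makes `φ` a completely bounded multiplier. -/
theorem cbNorm_le_of_implementing {σ₁ σ₂ : ContTwoCocycle G} {φ : G → ℂ} {ι : Type u} {a c r : ℝ}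
    (ha : 0 ≤ a) (hc : 0 ≤ c) {V W : Lp ℂ 2 μ →L[ℂ] lp (fun _ : ι => Lp ℂ 2 μ) 2}
    (hV : ∀ x, ‖V x‖ ≤ a * ‖x‖) (hW : ∀ x, ‖W x‖ ≤ c * ‖x‖)
    (h : ∀ s x y, inner ℂ (W y) (amplify ι (regularRep σ₂ μ s) (V x)) =
        φ s * inner ℂ y (regularRep σ₁ μ s x)) (hr : 0 < r) (hacr : a * c ≤ r) :
    ∃ hφ : IsMultiplier σ₁ σ₂ μ φ, cbNorm hφ.map ≤ ENNReal.ofReal r :=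
  have hφ := isMultiplier_of_implementing ha hV hW h
  ⟨hφ, cbNorm_le_of_sandwich ha hc hV hW (sandwich_mem_twistedVN h) hφ.map
    (pairing_map_eq_sandwich ha hV hW h hφ) hr hacr⟩

end Sufficiency

/-! ### Completely bounded multipliers are Schur multipliers -/

section Compression

variable {H : Type*} [NormedAddCommGroup H] [InnerProductSpace ℂ H] [CompleteSpace H]

/-- Test the form on `u = A w` and cancel. -/
theorem sum_norm_sq_le_of_bilinear {n : ℕ} {A : Fin n → Fin n → ℂ}
    (hA : ∀ w u : Fin n → ℂ, ‖∑ i, ∑ j, A i j * w j * conj (u i)‖ ^ 2 ≤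
      (∑ j, ‖w j‖ ^ 2) * ∑ i, ‖u i‖ ^ 2) (w : Fin n → ℂ) :
    ∑ i, ‖∑ j, A i j * w j‖ ^ 2 ≤ ∑ j, ‖w j‖ ^ 2 := by
  have h := hA w fun i => ∑ j, A i j * w j
  have h1 : ∑ i, ∑ j, A i j * w j * conj (∑ j, A i j * w j) =
      ((∑ i, ‖∑ j, A i j * w j‖ ^ 2 : ℝ) : ℂ) := by
    push_cast
    refine Finset.sum_congr rfl fun i _ => ?_
    rw [← Finset.sum_mul, Complex.mul_conj']
  rw [h1, Complex.norm_real, Real.norm_eq_abs, sq_abs, sq] at h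
  by_cases h0 : ∑ i, ‖∑ j, A i j * w j‖ ^ 2 = 0
  · rw [h0]; exact Finset.sum_nonneg fun _ _ => sq_nonneg _
  · exact le_of_mul_le_mul_right h
      (lt_of_le_of_ne (Finset.sum_nonneg fun _ _ => sq_nonneg _) (Ne.symm h0))

/-- A scalar contraction matrix acts contractively on tuples of vectors. -/
theorem sum_norm_sq_smul_le {n : ℕ} {A : Fin n → Fin n → ℂ}
    (hA : ∀ w u : Fin n → ℂ, ‖∑ i, ∑ j, A i j * w j * conj (u i)‖ ^ 2 ≤
      (∑ j, ‖w j‖ ^ 2) * ∑ i, ‖u i‖ ^ 2) (y : Fin n → H) :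
    ∑ i, ‖∑ j, A i j • y j‖ ^ 2 ≤ ∑ j, ‖y j‖ ^ 2 := by
  obtain ⟨ι, b, -⟩ := exists_hilbertBasis ℂ H
  have hb : ∀ v : H, HasSum (fun l => ‖inner ℂ (b l) v‖ ^ 2) (‖v‖ ^ 2) := fun v => by
    rw [← b.repr.norm_map v]
    simp only [← b.repr_apply_apply]
    exact hasSum_norm_sq (b.repr v)
  have h1 : HasSum (fun l => ∑ i, ‖inner ℂ (b l) (∑ j, A i j • y j)‖ ^ 2)
      (∑ i, ‖∑ j, A i j • y j‖ ^ 2) := hasSum_sum fun i _ => hb _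
  have h2 : HasSum (fun l => ∑ j, ‖inner ℂ (b l) (y j)‖ ^ 2) (∑ j, ‖y j‖ ^ 2) :=
    hasSum_sum fun i _ => hb _
  -- Both sides split over a Hilbert basis, and the scalar inequality applies in each coordinate.
  refine hasSum_le (fun l => ?_) h1 h2
  simp only [inner_sum, inner_smul_right]
  exact sum_norm_sq_le_of_bilinear hA fun j => inner ℂ (b l) (y j)

/-- The tuple of vectors with coordinates `v` in the family `f`. -/
noncomputable def expand {k m : ℕ} (f : Fin m → H) (v : EuclideanSpace ℂ (Fin k × Fin m)) :
    PiLp 2 (fun _ : Fin k => H) :=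
  WithLp.toLp 2 fun i => ∑ p, v (i, p) • f p

theorem expand_apply {k m : ℕ} (f : Fin m → H) (v : EuclideanSpace ℂ (Fin k × Fin m)) (i : Fin k) :
    expand f v i = ∑ p, v (i, p) • f p := rfl

theorem norm_expand {k m : ℕ} {f : Fin m → H} (hf : Orthonormal ℂ f)
    (v : EuclideanSpace ℂ (Fin k × Fin m)) : ‖expand f v‖ = ‖v‖ := by
  rw [← sq_eq_sq₀ (norm_nonneg _) (norm_nonneg _), norm_sq_eq_sum, EuclideanSpace.norm_sq_eq,
    Fintype.sum_prod_type]
  refine Finset.sum_congr rfl fun i _ => ?_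
  rw [expand_apply]
  have h : ((‖∑ p, v (i, p) • f p‖ ^ 2 : ℝ) : ℂ) = ((∑ p, ‖v (i, p)‖ ^ 2 : ℝ) : ℂ) := by
    push_cast
    rw [← Complex.coe_algebraMap, ← inner_self_eq_norm_sq_to_K, hf.inner_sum]
    exact Finset.sum_congr rfl fun p _ => Complex.conj_mul' _
  exact_mod_cast h

theorem exists_expand_eq {k m : ℕ} {F : Submodule ℂ H} (b : OrthonormalBasis (Fin m) ℂ F)
    (x : PiLp 2 (fun _ : Fin k => H)) (hx : ∀ i, x i ∈ F) :
    ∃ v : EuclideanSpace ℂ (Fin k × Fin m), expand (fun p => (b p : H)) v = x := by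
  refine ⟨WithLp.toLp 2 fun a => inner ℂ (b a.2 : H) (x a.1), ?_⟩
  ext i
  rw [expand_apply]
  have h := congrArg Subtype.val (b.sum_repr' ⟨x i, hx i⟩)
  simpa using h

theorem inner_toEuclideanCLM_compression {k m : ℕ} (f : Fin m → H)
    (S : Matrix (Fin k) (Fin k) (H →L[ℂ] H)) (u v : EuclideanSpace ℂ (Fin k × Fin m)) :
    inner ℂ u (Matrix.toEuclideanCLM (𝕜 := ℂ) (Matrix.of fun a b : Fin k × Fin m =>
      inner ℂ (f a.2) (S a.1 b.1 (f b.2))) v) = inner ℂ (expand f u) (matrixOp S (expand f v)) := by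
  rw [inner_matrixOp, PiLp.inner_apply, Fintype.sum_prod_type]
  refine Finset.sum_congr rfl fun i _ => ?_
  simp only [expand_apply, map_sum, map_smul, inner_sum, sum_inner, inner_smul_left,
    inner_smul_right, Matrix.ofLp_toEuclideanCLM, Matrix.mulVec, dotProduct, Matrix.of_apply,
    RCLike.inner_apply, Fintype.sum_prod_type, Finset.sum_mul]
  rw [Finset.sum_comm]
  refine Finset.sum_congr rfl fun j _ => ?_
  rw [Finset.sum_comm]
  refine Finset.sum_congr rfl fun q _ => ?_
  rw [Finset.mul_sum]
  refine Finset.sum_congr rfl fun p _ => ?_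
  ring

/-- The matrix `ψ` represents the compression of `M` to the span of `f`, which is completely
contractive because `expand f` is isometric. -/
theorem predualMatrixNorm_compression_le {M : VonNeumannAlgebra H} {m : ℕ} {f : Fin m → H}
    (hf : Orthonormal ℂ f) {ψ : Matrix (Fin m) (Fin m) (Predual M)}
    (hψ : ∀ p q (T : M.toStarSubalgebra),
      Predual.pairing M (ψ p q) T = inner ℂ (f p) ((T : H →L[ℂ] H) (f q))) :
    predualMatrixNorm ψ ≤ 1 := by
  refine iSup_le fun k => iSup_le fun T => iSup_le fun hT => ?_
  simp only [hψ]
  rw [← ofReal_norm]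
  refine ENNReal.ofReal_le_one.2 (ContinuousLinearMap.opNorm_le_bound _ zero_le_one fun v =>
    norm_apply_le_of_inner _ (fun u => ?_) zero_le_one)
  refine (congrArg norm (inner_toEuclideanCLM_compression f
    (T.map fun x => (x : H →L[ℂ] H)) u v)).trans_le ((norm_inner_le_norm _ _).trans ?_)
  rw [norm_expand hf, mul_comm, one_mul]
  refine mul_le_mul_of_nonneg_right ?_ (norm_nonneg _)
  refine (ContinuousLinearMap.le_opNorm _ _).trans ?_
  rw [norm_expand hf]
  exact mul_le_of_le_one_left (norm_nonneg _) hT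

end Compression

/-! ### The Schur bound extracted from the cb-norm -/

section Necessity

variable {G : Type u} [Group G] [TopologicalSpace G] [IsTopologicalGroup G]
  [MeasurableSpace G] [BorelSpace G] {μ : Measure G} [μ.IsHaarMeasure]

/-- The matrix `[A_{ij} λ_σ(z_i) λ_σ(z_j)]` over `VN(G, σ)`. -/
noncomputable def twistedMatrix (σ : ContTwoCocycle G) (μ : Measure G) [μ.IsHaarMeasure] {n : ℕ}
    (A : Fin n → Fin n → ℂ) (z : Fin n → G) :
    Matrix (Fin n) (Fin n) (twistedVN σ μ).toStarSubalgebra :=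
  Matrix.of fun i j => (A i j * σ (z i) (z j)) • regularRepVN σ μ (z i * z j)

/-- The matrix is the product `diag(λ_σ(z_i)) (A ⊗ 1) diag(λ_σ(z_j))`, and the two diagonal factors
are isometric. -/
theorem norm_matrixOp_twistedMatrix_le (σ : ContTwoCocycle G) {n : ℕ} {A : Fin n → Fin n → ℂ}
    (hA : ∀ w u : Fin n → ℂ, ‖∑ i, ∑ j, A i j * w j * conj (u i)‖ ^ 2 ≤
      (∑ j, ‖w j‖ ^ 2) * ∑ i, ‖u i‖ ^ 2) (z : Fin n → G) :
    ‖matrixOp ((twistedMatrix σ μ A z).map fun x => (x : Lp ℂ 2 μ →L[ℂ] Lp ℂ 2 μ))‖ ≤ 1 := by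
  refine ContinuousLinearMap.opNorm_le_bound _ zero_le_one fun x => ?_
  rw [one_mul, ← sq_le_sq₀ (norm_nonneg _) (norm_nonneg _), norm_sq_eq_sum, norm_sq_eq_sum]
  have h1 : ∀ i, matrixOp ((twistedMatrix σ μ A z).map fun x => (x : Lp ℂ 2 μ →L[ℂ] Lp ℂ 2 μ)) x i =
      regularRep σ μ (z i) (∑ j, A i j • regularRep σ μ (z j) (x j)) := fun i => by
    rw [matrixOp_apply, map_sum]
    refine Finset.sum_congr rfl fun j _ => ?_
    have h2 := congrArg (fun T : Lp ℂ 2 μ →L[ℂ] Lp ℂ 2 μ => T (x j)) (regularRep_mul σ μ (z i) (z j))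
    rw [map_smul]
    refine Eq.trans ?_ (congrArg (fun v => A i j • v) h2.symm)
    exact mul_smul (A i j) (σ (z i) (z j)) (regularRep σ μ (z i * z j) (x j))
  simp only [h1, norm_regularRep_apply]
  refine (sum_norm_sq_smul_le hA _).trans_eq ?_
  simp only [norm_regularRep_apply]

theorem toFun_map_vector {σ₁ σ₂ : ContTwoCocycle G} {φ : G → ℂ} (h : IsMultiplier σ₁ σ₂ μ φ)
    {ψ : FourierSpace σ₁ μ} {x y : Lp ℂ 2 μ}
    (hψ : ∀ T : (twistedVN σ₁ μ).toStarSubalgebra,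
      Predual.pairing _ ψ T = inner ℂ y ((T : Lp ℂ 2 μ →L[ℂ] Lp ℂ 2 μ) x)) (c : ℂ) (s : G) :
    Predual.pairing _ (h.map ψ) (c • regularRepVN σ₂ μ s) =
      inner ℂ y (((c * φ s) • regularRep σ₁ μ s) x) := by
  have h1 : Predual.pairing _ (h.map ψ) (regularRepVN σ₂ μ s) =
      φ s * inner ℂ y (regularRep σ₁ μ s x) :=
    (h.toFun_map ψ s).trans (congrArg (φ s * ·) (hψ (regularRepVN σ₁ μ s)))
  rw [map_smul, h1, smul_apply, inner_smul_right, smul_eq_mul, mul_assoc]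

/-- The cb-norm is applied to the compression matrix of `f`, and the result is evaluated at the
contraction `twistedMatrix σ₂ μ A z`. There `m_φ` turns `λ_{σ₂}` into `φ λ_{σ₁}`. -/
theorem norm_compression_map_le {σ₁ σ₂ : ContTwoCocycle G} {φ : G → ℂ}
    (h : IsMultiplier σ₁ σ₂ μ φ) {C : ℝ} (hC : 0 ≤ C) (hcb : cbNorm h.map ≤ ENNReal.ofReal C)
    {n m : ℕ} {A : Fin n → Fin n → ℂ}
    (hA : ∀ w u : Fin n → ℂ, ‖∑ i, ∑ j, A i j * w j * conj (u i)‖ ^ 2 ≤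
      (∑ j, ‖w j‖ ^ 2) * ∑ i, ‖u i‖ ^ 2) (z : Fin n → G) {f : Fin m → Lp ℂ 2 μ}
    (hf : Orthonormal ℂ f) :
    ‖Matrix.toEuclideanCLM (𝕜 := ℂ) (Matrix.of fun a b : Fin n × Fin m => inner ℂ (f a.2)
      (((A a.1 b.1 * σ₂ (z a.1) (z b.1) * φ (z a.1 * z b.1)) •
        regularRep σ₁ μ (z a.1 * z b.1)) (f b.2)))‖ ≤ C := by
  choose ψ hψ using fun p q => exists_predual_vector (twistedVN σ₁ μ) (f q) (f p)
  have h1 : predualMatrixNorm (Matrix.of ψ) ≤ 1 := predualMatrixNorm_compression_le hf hψ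
  have h2 : predualMatrixNorm ((Matrix.of ψ).map h.map) ≤ ENNReal.ofReal C := by
    refine le_trans ?_ hcb
    unfold cbNorm
    exact le_iSup₂_of_le m (Matrix.of ψ) (le_iSup_of_le h1 le_rfl)
  have h3 := norm_toEuclideanCLM_pairing_le h2 (twistedMatrix σ₂ μ A z)
    (norm_matrixOp_twistedMatrix_le σ₂ hA z)
  have h4 : (Matrix.of fun a b : Fin n × Fin m => Predual.pairing (twistedVN σ₂ μ)
      ((Matrix.of ψ).map h.map a.2 b.2) (twistedMatrix σ₂ μ A z a.1 b.1)) =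
      Matrix.of fun a b : Fin n × Fin m => inner ℂ (f a.2)
      (((A a.1 b.1 * σ₂ (z a.1) (z b.1) * φ (z a.1 * z b.1)) •
        regularRep σ₁ μ (z a.1 * z b.1)) (f b.2)) := by
    ext a b
    exact toFun_map_vector h (hψ a.2 b.2) _ _
  rw [h4, ← ofReal_norm] at h3
  exact (ENNReal.ofReal_le_ofReal_iff hC).1 h3

set_option maxHeartbeats 1600000 in
theorem schur_bound_fin [LocallyCompactSpace G] [T2Space G] {σ₁ σ₂ : ContTwoCocycle G} {φ : G → ℂ}
    (h : IsMultiplier σ₁ σ₂ μ φ) {C : ℝ} (hC : 0 ≤ C) (hcb : cbNorm h.map ≤ ENNReal.ofReal C)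
    {n : ℕ} {A : Fin n → Fin n → ℂ}
    (hA : ∀ w u : Fin n → ℂ, ‖∑ i, ∑ j, A i j * w j * conj (u i)‖ ^ 2 ≤
      (∑ j, ‖w j‖ ^ 2) * ∑ i, ‖u i‖ ^ 2) (z : Fin n → G) (w u : Fin n → ℂ) :
    ‖∑ i, ∑ j, A i j * ((star σ₁ * σ₂) (z i) (z j) * φ (z i * z j)) * w j * conj (u i)‖ ^ 2 ≤
      C ^ 2 * ((∑ j, ‖w j‖ ^ 2) * ∑ i, ‖u i‖ ^ 2) := by
  obtain ⟨x₀, hx₀⟩ := exists_norm_one (μ := μ)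
  -- Chosen so that pairing `U` with the matrix `S` applied to `X` gives the Schur product form, by
  -- `inner_regularRep_twist`. Compression to the finite-dimensional span `F` of their components
  -- loses nothing.
  let X : PiLp 2 (fun _ : Fin n => Lp ℂ 2 μ) :=
    WithLp.toLp 2 fun j => w j • star (regularRep σ₁ μ (z j)) x₀
  let U : PiLp 2 (fun _ : Fin n => Lp ℂ 2 μ) :=
    WithLp.toLp 2 fun i => u i • regularRep σ₁ μ (z i) x₀
  have hXj : ∀ j, X j = w j • star (regularRep σ₁ μ (z j)) x₀ := fun j => rfl
  have hUi : ∀ i, U i = u i • regularRep σ₁ μ (z i) x₀ := fun i => rfl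
  let F : Submodule ℂ (Lp ℂ 2 μ) := Submodule.span ℂ (Set.range X ∪ Set.range U)
  have : FiniteDimensional ℂ F := FiniteDimensional.span_of_finite ℂ
    ((Set.finite_range _).union (Set.finite_range _))
  let b := stdOrthonormalBasis ℂ F
  have hb : Orthonormal ℂ fun p => (b p : Lp ℂ 2 μ) :=
    b.orthonormal.comp_linearIsometry F.subtypeₗᵢ
  obtain ⟨x, hx⟩ := exists_expand_eq b X fun i => Submodule.subset_span (Or.inl ⟨i, rfl⟩)
  obtain ⟨y, hy⟩ := exists_expand_eq b U fun i => Submodule.subset_span (Or.inr ⟨i, rfl⟩)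
  have h1 := norm_compression_map_le h hC hcb hA z hb
  let S : Matrix (Fin n) (Fin n) (Lp ℂ 2 μ →L[ℂ] Lp ℂ 2 μ) := Matrix.of fun i j =>
    (A i j * σ₂ (z i) (z j) * φ (z i * z j)) • regularRep σ₁ μ (z i * z j)
  have h2 : inner ℂ U (matrixOp S X) =
      ∑ i, ∑ j, A i j * ((star σ₁ * σ₂) (z i) (z j) * φ (z i * z j)) * w j * conj (u i) := by
    rw [inner_matrixOp]
    refine Finset.sum_congr rfl fun i _ => Finset.sum_congr rfl fun j _ => ?_
    rw [hXj, hUi, ← inner_regularRep_twist σ₁ σ₂ φ hx₀]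
    simp only [S, Matrix.of_apply, smul_apply, map_smul, inner_smul_left, inner_smul_right]
    ring
  have h3 := inner_toEuclideanCLM_compression (fun p => (b p : Lp ℂ 2 μ)) S y x
  rw [hx, hy, h2] at h3
  have hX : ‖X‖ ^ 2 = ∑ j, ‖w j‖ ^ 2 := by
    simp only [norm_sq_eq_sum, hXj, norm_smul, norm_star_regularRep_apply, hx₀, mul_one]
  have hU : ‖U‖ ^ 2 = ∑ j, ‖u j‖ ^ 2 := by
    simp only [norm_sq_eq_sum, hUi, norm_smul, norm_regularRep_apply, hx₀, mul_one]
  rw [← h3, ← hX, ← hU, ← mul_pow, ← mul_pow, ← hx, ← hy, norm_expand hb, norm_expand hb]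
  refine pow_le_pow_left₀ (norm_nonneg _) ((norm_inner_le_norm _ _).trans ?_) 2
  have h4 := (ContinuousLinearMap.le_opNorm _ x).trans
    (mul_le_mul_of_nonneg_right h1 (norm_nonneg x))
  calc ‖y‖ * _ ≤ ‖y‖ * (C * ‖x‖) := mul_le_mul_of_nonneg_left h4 (norm_nonneg _)
    _ = C * (‖x‖ * ‖y‖) := by ring

theorem schur_bound_of_cbNorm_le [LocallyCompactSpace G] [T2Space G] {σ₁ σ₂ : ContTwoCocycle G}
    {φ : G → ℂ} (h : IsMultiplier σ₁ σ₂ μ φ) {C : ℝ} (hC : 0 ≤ C)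
    (hcb : cbNorm h.map ≤ ENNReal.ofReal C) (Z : Finset G) (a : G → G → ℂ)
    (ha : ∀ w u : G → ℂ, ‖∑ t ∈ Z, ∑ s ∈ Z, a t s * w s * conj (u t)‖ ^ 2 ≤
      (∑ s ∈ Z, ‖w s‖ ^ 2) * ∑ t ∈ Z, ‖u t‖ ^ 2) (w u : G → ℂ) :
    ‖∑ t ∈ Z, ∑ s ∈ Z, a t s * ((star σ₁ * σ₂) t s * φ (t * s)) * w s * conj (u t)‖ ^ 2 ≤
      C ^ 2 * ((∑ s ∈ Z, ‖w s‖ ^ 2) * ∑ t ∈ Z, ‖u t‖ ^ 2) := by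
  classical
  let e := Z.equivFin
  let z : Fin Z.card → G := fun i => e.symm i
  have hz : Function.Injective z := Subtype.val_injective.comp e.symm.injective
  have hsum : ∀ {E : Type} [AddCommMonoid E] (g : G → E), ∑ s ∈ Z, g s = ∑ i, g (z i) := by
    intro E _ g
    rw [← Finset.sum_coe_sort Z g]
    exact (Equiv.sum_comp e.symm fun s : Z => g s).symm
  have hA : ∀ w u : Fin Z.card → ℂ, ‖∑ i, ∑ j, a (z i) (z j) * w j * conj (u i)‖ ^ 2 ≤
      (∑ j, ‖w j‖ ^ 2) * ∑ i, ‖u i‖ ^ 2 := by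
    intro w u
    have h1 := ha (Function.extend z w 0) (Function.extend z u 0)
    simpa only [hsum, hz.extend_apply] using h1
  have h1 := schur_bound_fin h hC hcb hA z (fun j => w (z j)) fun i => u (z i)
  simpa only [hsum] using h1

end Necessity

/-! ### The two directions with their norm bounds -/

section Main

variable {G : Type u} [Group G] [TopologicalSpace G] [IsTopologicalGroup G]
  [LocallyCompactSpace G] [T2Space G] [MeasurableSpace G] [BorelSpace G]
  {μ : Measure G} [μ.IsHaarMeasure] [μ.Regular] {σ₁ σ₂ : ContTwoCocycle G} {φ : G → ℂ}

theorem exists_cbNorm_le_of_gram {H : Type u} [NormedAddCommGroup H] [InnerProductSpace ℂ H]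
    [CompleteSpace H] (ξ η : BoundedContinuousFunction G H)
    (hk : ∀ s t, (star σ₁ * σ₂) t s * φ (t * s) = inner ℂ (η t) (ξ s)) {r : ℝ} (hr : 0 < r)
    (h : ‖ξ‖ * ‖η‖ ≤ r) : ∃ hφ : IsMultiplier σ₁ σ₂ μ φ, cbNorm hφ.map ≤ ENNReal.ofReal r := by
  obtain ⟨ι, V, W, hV, hW, hVW⟩ := exists_implementing_ops (μ := μ) (norm_nonneg ξ) (norm_nonneg η)
    ξ.norm_coe_le_norm η.norm_coe_le_norm (fun v => continuous_const.inner ξ.continuous)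
    (fun v => continuous_const.inner η.continuous) hk
  exact cbNorm_le_of_implementing (norm_nonneg ξ) (norm_nonneg η) hV hW hVW hr h

/-- The algebraic factorization has both families of norm `√C`; passing to weakly continuous and
then to norm continuous vectors preserves these bounds. -/
theorem exists_gram_of_cbNorm_le (hφ : IsMultiplier σ₁ σ₂ μ φ) {C : ℝ} (hC : 0 ≤ C)
    (hcb : cbNorm hφ.map ≤ ENNReal.ofReal C) :
    ∃ (H : Type u) (_ : NormedAddCommGroup H) (_ : InnerProductSpace ℂ H) (_ : CompleteSpace H)
      (ξ η : BoundedContinuousFunction G H), ‖ξ‖ ≤ √C ∧ ‖η‖ ≤ √C ∧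
        ∀ s t : G, (star σ₁ * σ₂) t s * φ (t * s) = inner ℂ (η t) (ξ s) := by
  let k : G → G → ℂ := fun t s => (star σ₁ * σ₂) t s * φ (t * s)
  obtain ⟨H, _, _, _, ξ, η, hξ, hη, hk⟩ := exists_gram_of_dominated k
    (dominated_of_schur_bound k hC (schur_bound_of_cbNorm_le hφ hC hcb))
  have hcont := hφ.continuous
  have k₁ : ∀ t, Continuous fun s => k t s := fun t =>
    ((star σ₁ * σ₂).continuous'.comp (continuous_const.prodMk continuous_id)).mul
      (hcont.comp (continuous_const_mul t))
  have k₂ : ∀ s, Continuous fun t => k t s := fun s =>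
    ((star σ₁ * σ₂).continuous'.comp (continuous_id.prodMk continuous_const)).mul
      (hcont.comp (continuous_mul_const s))
  obtain ⟨ξ', η', hξ', hη', hk', cξ, cη⟩ := exists_weaklyContinuous_gram
    (fun s => Real.le_sqrt_of_sq_le (hξ s).le) (fun t => Real.le_sqrt_of_sq_le (hη t).le) hk k₁ k₂
  obtain ⟨ι, V, W, hV, hW, hVW⟩ := exists_implementing_ops (μ := μ) (Real.sqrt_nonneg C)
    (Real.sqrt_nonneg C) hξ' hη' cξ cη fun s t => (hk' s t).symm
  obtain ⟨ξ'', η'', c₁, c₂, n₁, n₂, hk''⟩ := exists_continuous_gram hV hW hVW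
  exact ⟨_, inferInstance, inferInstance, inferInstance,
    BoundedContinuousFunction.ofNormedAddCommGroup ξ'' c₁ _ n₁,
    BoundedContinuousFunction.ofNormedAddCommGroup η'' c₂ _ n₂,
    BoundedContinuousFunction.norm_ofNormedAddCommGroup_le _ (Real.sqrt_nonneg C) _,
    BoundedContinuousFunction.norm_ofNormedAddCommGroup_le _ (Real.sqrt_nonneg C) _, hk''⟩

end Main

end TwistedFourier

theorem mainTheorem3 {G : Type u} [Group G] [TopologicalSpace G] [IsTopologicalGroup G]
    [LocallyCompactSpace G] [T2Space G] [MeasurableSpace G] [BorelSpace G]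
    (μ : MeasureTheory.Measure G) [μ.IsHaarMeasure] [μ.Regular]
    (σ₁ σ₂ : TwistedFourier.ContTwoCocycle G) (φ : G → ℂ) :
    (φ ∈ TwistedFourier.cbMultipliers σ₁ σ₂ μ ↔
      ∃ (H : Type u) (_ : NormedAddCommGroup H) (_ : InnerProductSpace ℂ H) (_ : CompleteSpace H)
        (ξ η : BoundedContinuousFunction G H),
        ∀ s t : G, (star σ₁ * σ₂) t s * φ (t * s) = inner ℂ (η t) (ξ s)) ∧
    TwistedFourier.cbMultiplierNorm σ₁ σ₂ μ φ =
      sInf {r : ENNReal | ∃ (H : Type u) (_ : NormedAddCommGroup H) (_ : InnerProductSpace ℂ H)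
        (_ : CompleteSpace H) (ξ η : BoundedContinuousFunction G H),
        (∀ s t : G, (star σ₁ * σ₂) t s * φ (t * s) = inner ℂ (η t) (ξ s)) ∧ r = ‖ξ‖ₑ * ‖η‖ₑ} := by
  refine ⟨⟨?_, ?_⟩, le_antisymm ?_ ?_⟩
  · rintro ⟨hφ, hlt⟩
    obtain ⟨H, i₁, i₂, i₃, ξ, η, -, -, hk⟩ := TwistedFourier.exists_gram_of_cbNorm_le hφ
      ENNReal.toReal_nonneg (ENNReal.ofReal_toReal hlt.ne).ge
    exact ⟨H, i₁, i₂, i₃, ξ, η, hk⟩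
  · rintro ⟨H, _, _, _, ξ, η, hk⟩
    -- The bound must be strictly positive, while `‖ξ‖ ‖η‖` may be zero; hence the `+ 1` here and
    -- the `+ ε` in the norm estimate.
    obtain ⟨hφ, h⟩ := TwistedFourier.exists_cbNorm_le_of_gram (μ := μ) ξ η hk
      (r := ‖ξ‖ * ‖η‖ + 1) (by positivity) (by linarith)
    exact ⟨hφ, h.trans_lt ENNReal.ofReal_lt_top⟩
  · refine le_sInf ?_
    rintro _ ⟨H, _, _, _, ξ, η, hk, rfl⟩
    refine ENNReal.le_of_forall_pos_le_add fun ε hε _ => ?_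
    obtain ⟨hφ, h⟩ := TwistedFourier.exists_cbNorm_le_of_gram (μ := μ) ξ η hk
      (r := ‖ξ‖ * ‖η‖ + ε) (by positivity) (by simp)
    refine (iInf_le _ hφ).trans (h.trans_eq ?_)
    rw [ENNReal.ofReal_add (by positivity) (by positivity), ENNReal.ofReal_mul (norm_nonneg _),
      ofReal_norm, ofReal_norm, ENNReal.ofReal_coe_nnreal]
  · refine le_iInf fun hφ => ?_
    by_cases htop : TwistedFourier.cbNorm hφ.map = ⊤
    · rw [htop]; exact le_top
    set C := (TwistedFourier.cbNorm hφ.map).toReal with hCdef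
    have hC : ENNReal.ofReal C = TwistedFourier.cbNorm hφ.map := ENNReal.ofReal_toReal htop
    have hC0 : 0 ≤ C := ENNReal.toReal_nonneg
    -- Taking `C` equal to the cb-norm, the two bounds `√C` multiply to `C`, so the infimum is
    -- attained whenever it is finite.
    obtain ⟨H, i₁, i₂, i₃, ξ, η, n₁, n₂, hk⟩ := TwistedFourier.exists_gram_of_cbNorm_le hφ hC0 hC.ge
    refine le_trans (sInf_le (a := ‖ξ‖ₑ * ‖η‖ₑ) ?_) ?_
    · exact ⟨H, i₁, i₂, i₃, ξ, η, hk, rfl⟩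
    rw [← ofReal_norm, ← ofReal_norm, ← ENNReal.ofReal_mul (norm_nonneg _), ← hC]
    refine ENNReal.ofReal_le_ofReal ((mul_le_mul n₁ n₂ (norm_nonneg _) (Real.sqrt_nonneg C)).trans ?_)
    rw [Real.mul_self_sqrt hC0]
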